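/- **Setting.** A symmetry is a pair $(G,\phi)$ of a topological group $G$ (discrete if no topology is specified) and a continuous homomorphism $\phi:G\to\{\pm1\}$ recording which elements reverse the orientation of spacetime. A morphism $(G_1,\phi_1)\to(G_2,\phi_2)$ is a continuous homomorphism $f:G_1\to G_2$ with $\phi_2\circ f=\phi_1$. For each dimension $d\ge 0$, the $d$-dimensional topological phases with symmetry $(G,\phi)$ form a commutative monoid under stacking, and every morphism $f$ induces a monoid homomorphism $f^*$ from phases with symmetry $(G_2,\phi_2)$ to phases with symmetry $(G_1,\phi_1)$, with $(f_2\circ f_1)^*=f_1^*\circ f_2^*$ and $\mathrm{id}^*=\mathrm{id}$. The SPT phases are the invertible elements; they form an abelian group $\mathcal{SPT}^d(G,\phi)$, contravariantly functorial in $(G,\phi)$. (No other property of phases is used, so the statement applies to bosonic phases, and to fermionic phases with fixed intrinsically fermionic symmetry.) An $\Omega$-spectrum is a family of pointed spaces $(F_n)_{n\in\mathbb Z}$ with pointed homotopy equivalences $F_n\simeq\Omega F_{n+1}$. Put $h^n(X,Y)=[(X,Y),(F_n,*)]$ (homotopy classes of maps of pairs, added by concatenating loops via $F_n\simeq\Omega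 F_{n+1}$), $h^n_G(X,Y)=h^n(EG\times_G X,EG\times_G Y)$ with $EG\to BG$ the universal principal $G$-bundle, and $h^{\phi+n}_G(X,Y)=h^{n+1}_G(X\times\tilde I,\;Y\times\tilde I\cup X\times\partial\tilde I)$, where $\tilde I=[0,1]$ with $G$-action $g.x=\tfrac12+\phi(g)(x-\tfrac12)$. **Generalized cohomology hypothesis** (for a class $\mathcal G$ of symmetries, e.g. all of them): there is an $\Omega$-spectrum $(F_n)_{n\in\mathbb Z}$ such that for all $d\ge0$ and all $(G,\phi)\in\mathcal G$ there are isomorphisms of abelian groups $\mathcal{SPT}^d(G,\phi)\cong h^{\phi+d}_G(\mathrm{pt})$, natural with respect to all morphisms between members of $\mathcal G$. **Proposition.** Assume the generalized cohomology hypothesis for $\mathcal G$. Let $G$ be an arbitrary topological group and let $\phi:\mathbb Z\times G\to\{\pm1\}$ be a continuous homomorphism for which the generator of $\mathbb Z$ is a pure translation, so that $\phi(1,e)=1$; write $\phi|_G$ for the restriction of $\phi$ to $G$, and suppose that $(\mathbb Z\times G,\phi)$ and $(G,\phi|_G)$ belong to $\mathcal G$. Then for every $d\ge1$ there is a split short exact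 sequence of abelian groups $$0\to\mathcal{SPT}^{d-1}(G,\phi|_G)\to\mathcal{SPT}^d(\mathbb Z\times G,\phi)\to\mathcal{SPT}^d(G,\phi|_G)\to0,$$ in which the second map is the one that forgets the translational symmetry, i.e. the map induced by the inclusion $G\hookrightarrow\mathbb Z\times G$. In particular, $$\mathcal{SPT}^d(\mathbb Z\times G,\phi)\cong\mathcal{SPT}^{d-1}(G,\phi|_G)\oplus\mathcal{SPT}^d(G,\phi|_G).$$ -/

import Mathlib

open scoped unitInterval

universe u v w

noncomputable section

/-! ## Homotopy classes of maps of pairs, and cohomology of an Ω-spectrum -/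

/-- Continuous maps `X → Y` that send all of `A ⊆ X` to the point `y₀`,
i.e. maps of pairs `(X, A) → (Y, y₀)`. -/
def PairMap (X : Type*) [TopologicalSpace X] (A : Set X) (Y : Type*) [TopologicalSpace Y]
    (y₀ : Y) : Type _ :=
  {f : C(X, Y) // ∀ a ∈ A, f a = y₀}

namespace PairMap

variable {X : Type*} [TopologicalSpace X] {A : Set X} {Y : Type*} [TopologicalSpace Y] {y₀ : Y}

/-- Two maps of pairs are homotopic if they are joined by a homotopy through maps of pairs. -/
instance setoid (X : Type*) [TopologicalSpace X] (A : Set X) (Y : Type*) [TopologicalSpace Y]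
    (y₀ : Y) : Setoid (PairMap X A Y y₀) where
  r f g := ContinuousMap.HomotopicWith f.1 g.1 (fun k => ∀ a ∈ A, k a = y₀)
  iseqv :=
    { refl := fun f => ContinuousMap.HomotopicWith.refl f.1 f.2
      symm := fun h => h.symm
      trans := fun h₁ h₂ => h₁.trans h₂ }

end PairMap

/-- An Ω-spectrum: pointed spaces `F n`, `n ∈ ℤ`, with pointed homotopy equivalences
`F n ≃ Ω (F (n + 1))`. -/
structure OmegaSpectrum where
  /-- the spaces -/
  space : ℤ → Type*
  /-- their topologies -/
  top : ∀ n, TopologicalSpace (space n)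
  /-- the basepoints -/
  pt : ∀ n, space n
  /-- the pointed map `F n → Ω (F (n + 1))` -/
  toLoop : ∀ n, C(space n, Path (pt (n + 1)) (pt (n + 1)))
  /-- the pointed map `Ω (F (n + 1)) → F n` -/
  ofLoop : ∀ n, C(Path (pt (n + 1)) (pt (n + 1)), space n)
  toLoop_pt : ∀ n, toLoop n (pt n) = Path.refl (pt (n + 1))
  ofLoop_refl : ∀ n, ofLoop n (Path.refl (pt (n + 1))) = pt n
  ofLoop_toLoop : ∀ n, ((ofLoop n).comp (toLoop n)).HomotopicRel (ContinuousMap.id _) {pt n}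
  toLoop_ofLoop : ∀ n, ((toLoop n).comp (ofLoop n)).HomotopicRel (ContinuousMap.id _)
    {Path.refl (pt (n + 1))}

attribute [instance] OmegaSpectrum.top

/-- `hⁿ(X, A) = [(X, A), (F n, pt)]`. -/
def Cohomology (F : OmegaSpectrum) (n : ℤ) (X : Type*) [TopologicalSpace X] (A : Set X) : Type _ :=
  Quotient (PairMap.setoid X A (F.space n) (F.pt n))

namespace Cohomology

variable (F : OmegaSpectrum) (n : ℤ) {X X' : Type*} [TopologicalSpace X] [TopologicalSpace X']
  {A : Set X} {A' : Set X'}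

/-- Concatenation of loops in `F (n + 1)`, transported to `F n`. -/
def loopAdd : C(F.space n × F.space n, F.space n) where
  toFun p := F.ofLoop n ((F.toLoop n p.1).trans (F.toLoop n p.2))
  continuous_toFun := by
    have h : Continuous fun p : F.space n × F.space n => (F.toLoop n p.1, F.toLoop n p.2) := by
      fun_prop
    exact (F.ofLoop n).continuous.comp (Path.continuous_trans.comp h)

theorem loopAdd_pt : loopAdd F n (F.pt n, F.pt n) = F.pt n := by
  simp [loopAdd, F.toLoop_pt, F.ofLoop_refl]

/-- The sum of two maps of pairs, by pointwise concatenation of loops. -/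
def addRep (a b : PairMap X A (F.space n) (F.pt n)) : PairMap X A (F.space n) (F.pt n) :=
  ⟨(loopAdd F n).comp (a.1.prodMk b.1), fun x hx => by
    simp [a.2 x hx, b.2 x hx, loopAdd_pt]⟩

/-- The addition of `hⁿ(X, A)`, induced by concatenation of loops under
`F n ≃ Ω (F (n + 1))`. -/
instance : Add (Cohomology F n X A) where
  add := Quotient.map₂ (addRep F n) (by
    rintro a a' ⟨H⟩ b b' ⟨K⟩
    refine ⟨⟨⟨(loopAdd F n).comp (H.toContinuousMap.prodMk K.toContinuousMap), ?_, ?_⟩, ?_⟩⟩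
    · intro x; simp [addRep]
    · intro x; simp [addRep]
    · intro t x hx
      have h₁ : H (t, x) = F.pt n := H.prop' t x hx
      have h₂ : K (t, x) = F.pt n := K.prop' t x hx
      change loopAdd F n (H (t, x), K (t, x)) = F.pt n
      rw [h₁, h₂, loopAdd_pt])

/-- The map `hⁿ(X', A') → hⁿ(X, A)` induced by a map of pairs `(X, A) → (X', A')`. -/
def pullback (f : C(X, X')) (hf : ∀ a ∈ A, f a ∈ A') :
    Cohomology F n X' A' → Cohomology F n X A :=
  Quotient.map (fun a => ⟨a.1.comp f, fun x hx => a.2 _ (hf x hx)⟩) (by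
    rintro a a' ⟨H⟩
    refine ⟨⟨⟨H.toContinuousMap.comp
      ((ContinuousMap.id I).prodMap f), ?_, ?_⟩, ?_⟩⟩
    · intro x; simp
    · intro x; simp
    · intro t x hx
      exact H.prop' t (f x) (hf x hx))

end Cohomology

/-! ## The universal principal bundle of a topological group -/

/-- The total space `EG` of Milnor's universal principal `G`-bundle (infinite join of copies of
`G`): formal convex combinations `∑ t i • g i` over `i ∈ ℕ` with finitely many nonzero `t i`, where
`g i` is disregarded if `t i = 0`. In this encoding a disregarded `g i` is given the value `1`. -/
@[ext]
structure EG (G : Type*) [Group G] where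
  /-- the weights -/
  t : ℕ → ℝ
  /-- the group elements -/
  g : ℕ → G
  t_nonneg : ∀ i, 0 ≤ t i
  t_finite : t.support.Finite
  t_sum : ∑ᶠ i, t i = 1
  g_eq_one : ∀ i, t i = 0 → g i = 1

namespace EG

variable {G H : Type*} [Group G] [Group H]

/-- The coarsest topology for which all `t i : EG → ℝ` and all `g i : {x | t i x ≠ 0} → G` are
continuous. -/
instance [TopologicalSpace G] : TopologicalSpace (EG G) :=
  TopologicalSpace.generateFrom
    ({s | ∃ (i : ℕ) (U : Set ℝ), IsOpen U ∧ s = {x : EG G | x.t i ∈ U}} ∪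
      {s | ∃ (i : ℕ) (V : Set G), IsOpen V ∧ s = {x : EG G | x.t i ≠ 0 ∧ x.g i ∈ V}})

open scoped Classical in
/-- `G` acts by left multiplication on all group elements of positive weight. -/
instance : MulAction G (EG G) where
  smul h x :=
    { t := x.t
      g := fun i => if x.t i = 0 then 1 else h * x.g i
      t_nonneg := x.t_nonneg
      t_finite := x.t_finite
      t_sum := x.t_sum
      g_eq_one := fun i hi => by simp [hi] }
  one_smul x := by
    ext i
    · rfl
    · change (if x.t i = 0 then 1 else 1 * x.g i) = x.g i
      split_ifs with hi
      · exact (x.g_eq_one i hi).symm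
      · exact one_mul _
  mul_smul a b x := by
    ext i
    · rfl
    · change (if x.t i = 0 then 1 else a * b * x.g i) =
        (if x.t i = 0 then 1 else a * (if x.t i = 0 then 1 else b * x.g i))
      split_ifs with hi
      · rfl
      · exact mul_assoc _ _ _

open scoped Classical in
theorem smul_g (h : G) (x : EG G) (i : ℕ) :
    (h • x).g i = if x.t i = 0 then 1 else h * x.g i := rfl

theorem smul_t (h : G) (x : EG G) (i : ℕ) : (h • x).t i = x.t i := rfl

/-- The map `EG → EH` induced by a homomorphism `f : G → H`. -/
def map (f : G →* H) (x : EG G) : EG H where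
  t := x.t
  g i := f (x.g i)
  t_nonneg := x.t_nonneg
  t_finite := x.t_finite
  t_sum := x.t_sum
  g_eq_one i hi := by rw [x.g_eq_one i hi, map_one]

theorem map_smul (f : G →* H) (h : G) (x : EG G) : map f (h • x) = f h • map f x := by
  ext i
  · rfl
  · simp only [map, smul_g]
    split_ifs <;> simp

theorem continuous_map [TopologicalSpace G] [TopologicalSpace H] (f : G →* H)
    (hf : Continuous f) : Continuous (map f) := by
  refine continuous_generateFrom_iff.2 ?_
  rintro s (⟨i, U, hU, rfl⟩ | ⟨i, V, hV, rfl⟩)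
  · exact TopologicalSpace.isOpen_generateFrom_of_mem (Or.inl ⟨i, U, hU, rfl⟩)
  · exact TopologicalSpace.isOpen_generateFrom_of_mem
      (Or.inr ⟨i, f ⁻¹' V, hV.preimage hf, rfl⟩)

end EG

/-! ## Equivariant and twisted equivariant cohomology -/

/-- The quotient `EG ×_G X = (EG × X) / G` by the diagonal action. -/
abbrev BorelConstruction (G X : Type*) [Group G] [TopologicalSpace G] [TopologicalSpace X]
    [MulAction G X] : Type _ :=
  MulAction.orbitRel.Quotient G (EG G × X)

/-- The subset `EG ×_G Y` of `EG ×_G X`, for `Y ⊆ X`. -/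
def borelSubset (G : Type*) {X : Type*} [Group G] [TopologicalSpace G] [TopologicalSpace X]
    [MulAction G X] (Y : Set X) : Set (BorelConstruction G X) :=
  {q | ∃ (e : EG G) (y : X), y ∈ Y ∧ q = Quotient.mk _ (e, y)}

/-- Borel equivariant cohomology `hⁿ_G(X, Y) = hⁿ(EG ×_G X, EG ×_G Y)`. -/
abbrev EquivariantCohomology (F : OmegaSpectrum) (n : ℤ) (G : Type*) [Group G]
    [TopologicalSpace G] (X : Type*) [TopologicalSpace X] [MulAction G X] (Y : Set X) : Type _ :=
  Cohomology F n (BorelConstruction G X) (borelSubset G Y)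

/-- The unit interval on which `G` acts by `g • x = 1/2 + φ(g) (x - 1/2)`. -/
def TwistedInterval {G : Type*} [Group G] [TopologicalSpace G] (_φ : G →ₜ* ℤˣ) : Type := I

namespace TwistedInterval

variable {G : Type*} [Group G] [TopologicalSpace G] (φ : G →ₜ* ℤˣ)

instance : TopologicalSpace (TwistedInterval φ) := inferInstanceAs (TopologicalSpace I)

/-- The underlying real number. -/
def val {φ : G →ₜ* ℤˣ} (x : TwistedInterval φ) : ℝ := Subtype.val (p := (· ∈ I)) x

theorem val_mem {φ : G →ₜ* ℤˣ} (x : TwistedInterval φ) : x.val ∈ I :=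
  Subtype.property (p := (· ∈ I)) x

@[ext]
theorem ext {φ : G →ₜ* ℤˣ} {x y : TwistedInterval φ} (h : x.val = y.val) : x = y :=
  Subtype.ext h

instance : MulAction G (TwistedInterval φ) where
  smul g x := ⟨1 / 2 + ((φ g : ℤ) : ℝ) * (x.val - 1 / 2), by
    have h := x.val_mem
    rcases Int.units_eq_one_or (φ g) with hg | hg <;> rw [hg] <;>
      constructor <;> push_cast <;> linarith [h.1, h.2]⟩
  one_smul x := by
    ext
    change 1 / 2 + ((φ 1 : ℤ) : ℝ) * (x.val - 1 / 2) = x.val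
    simp
  mul_smul a b x := by
    ext
    change 1 / 2 + ((φ (a * b) : ℤ) : ℝ) * (x.val - 1 / 2) =
      1 / 2 + ((φ a : ℤ) : ℝ) * (1 / 2 + ((φ b : ℤ) : ℝ) * (x.val - 1 / 2) - 1 / 2)
    rw [map_mul]
    push_cast
    ring

theorem smul_val (g : G) (x : TwistedInterval φ) :
    (g • x).val = 1 / 2 + ((φ g : ℤ) : ℝ) * (x.val - 1 / 2) := rfl

/-- The two endpoints. -/
def boundary : Set (TwistedInterval φ) := {x | x.val = 0 ∨ x.val = 1}

end TwistedInterval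

/-- Twisted equivariant cohomology
`h^{φ+n}_G(X, Y) = h^{n+1}_G(X × Ĩ, Y × Ĩ ∪ X × ∂Ĩ)`, where `Ĩ` is the twisted interval. -/
abbrev TwistedCohomology (F : OmegaSpectrum) (n : ℤ) {G : Type*} [Group G] [TopologicalSpace G]
    (φ : G →ₜ* ℤˣ) (X : Type*) [TopologicalSpace X] [MulAction G X] (Y : Set X) : Type _ :=
  EquivariantCohomology F (n + 1) G (X × TwistedInterval φ)
    (Y ×ˢ Set.univ ∪ Set.univ ×ˢ TwistedInterval.boundary φ)

/-! ## Symmetry groups and the functoriality of `h^{φ+n}_G(pt)` in `(G, φ)` -/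

/-- A symmetry group `G` with the homomorphism `φ : G → {±1}` that records which elements reverse
the orientation of spacetime. A group without topology is regarded as a discrete group. -/
structure Symmetry where
  /-- the group -/
  G : Type*
  group : Group G
  top : TopologicalSpace G
  isTopologicalGroup : IsTopologicalGroup G
  /-- the orientation homomorphism -/
  φ : G →ₜ* ℤˣ

attribute [instance] Symmetry.group Symmetry.top Symmetry.isTopologicalGroup

/-- The symmetry group `G` with orientation homomorphism `φ`. -/
abbrev Symmetry.of {G : Type*} [Group G] [TopologicalSpace G] [IsTopologicalGroup G]
    (φ : G →ₜ* ℤˣ) : Symmetry :=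
  ⟨G, inferInstance, inferInstance, inferInstance, φ⟩

/-- A morphism `(G₁, φ₁) → (G₂, φ₂)`: a homomorphism `f : G₁ → G₂` with `φ₂ ∘ f = φ₁`. -/
structure Symmetry.Hom (S T : Symmetry) where
  /-- the homomorphism of groups -/
  toHom : S.G →ₜ* T.G
  comm : ∀ g, T.φ (toHom g) = S.φ g

/-- The identity morphism. -/
def Symmetry.Hom.id (S : Symmetry) : Symmetry.Hom S S :=
  ⟨ContinuousMonoidHom.id S.G, fun _ => rfl⟩

/-- Composition `f₂ ∘ f₁` of morphisms. -/
def Symmetry.Hom.comp {S T U : Symmetry} (f₂ : Symmetry.Hom T U) (f₁ : Symmetry.Hom S T) :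
    Symmetry.Hom S U :=
  ⟨f₂.toHom.comp f₁.toHom, fun g => (f₂.comm (f₁.toHom g)).trans (f₁.comm g)⟩

/-- The group `h^{φ+n}_G(pt)`. -/
abbrev PointCohomology (F : OmegaSpectrum) (n : ℤ) (S : Symmetry) : Type _ :=
  TwistedCohomology F n S.φ PUnit.{1} ∅

namespace Symmetry.Hom

variable {S T : Symmetry} (f : Symmetry.Hom S T)

/-- The map `EG₁ × (pt × Ĩ) → EG₂ × (pt × Ĩ)` induced by `f : G₁ → G₂`. -/
def prodMap : EG S.G × (PUnit.{1} × TwistedInterval S.φ) →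
    EG T.G × (PUnit.{1} × TwistedInterval T.φ) :=
  fun p => (EG.map f.toHom.toMonoidHom p.1, (p.2.1, (p.2.2 : I)))

theorem continuous_prodMap : Continuous f.prodMap := by
  refine Continuous.prodMk ((EG.continuous_map _ f.toHom.continuous_toFun).comp continuous_fst) ?_
  exact Continuous.prodMk (continuous_fst.comp continuous_snd) (continuous_snd.comp continuous_snd)

theorem prodMap_smul (g : S.G) (p : EG S.G × (PUnit.{1} × TwistedInterval S.φ)) :
    f.prodMap (g • p) = f.toHom g • f.prodMap p := by
  refine Prod.ext (EG.map_smul _ g p.1) (Prod.ext rfl ?_)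
  refine TwistedInterval.ext ?_
  change 1 / 2 + ((S.φ g : ℤ) : ℝ) * (p.2.2.val - 1 / 2) =
    1 / 2 + ((T.φ (f.toHom g) : ℤ) : ℝ) * (p.2.2.val - 1 / 2)
  rw [f.comm g]

/-- The map `EG₁ ×_{G₁} (pt × Ĩ) → EG₂ ×_{G₂} (pt × Ĩ)` induced by `f : G₁ → G₂`. -/
def borelMap : C(BorelConstruction S.G (PUnit.{1} × TwistedInterval S.φ),
    BorelConstruction T.G (PUnit.{1} × TwistedInterval T.φ)) where
  toFun := Quotient.map f.prodMap (by
    rintro a b ⟨g, rfl⟩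
    exact ⟨f.toHom g, (f.prodMap_smul g b).symm⟩)
  continuous_toFun :=
    Continuous.quotient_map' f.continuous_prodMap _

/-- The induced map `f^* : h^{φ₂+n}_{G₂}(pt) → h^{φ₁+n}_{G₁}(pt)`. -/
def pullback (F : OmegaSpectrum) (n : ℤ) : PointCohomology F n T → PointCohomology F n S :=
  Cohomology.pullback F (n + 1) f.borelMap (by
    rintro _ ⟨e, ⟨u, x⟩, h, rfl⟩
    refine ⟨EG.map f.toHom.toMonoidHom e, (u, (x : I)), ?_, rfl⟩
    rcases h with h | h
    · exact absurd h.1 (Set.notMem_empty _)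
    · exact Or.inr ⟨trivial, h.2⟩)

end Symmetry.Hom

/-! ## SPT phases and the generalized cohomology hypothesis -/

/-- A theory of topological phases (bosonic, or fermionic with fixed intrinsically fermionic
symmetry): for every dimension `d` and every symmetry `(G, φ)` the commutative monoid of
`d`-dimensional `G`-equivariant topological phases under stacking, contravariantly functorial in
`(G, φ)` by forgetting and relabelling symmetries. -/
structure TopologicalPhases where
  /-- the `d`-dimensional phases with symmetry `S` -/
  Phase : ℕ → Symmetry.{u} → Type w
  /-- stacking -/
  stacking : ∀ d S, AddCommMonoid (Phase d S)
  /-- the map induced by a morphism of symmetries -/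
  pullback : ∀ (d : ℕ) {S T : Symmetry.{u}}, Symmetry.Hom S T → (Phase d T →+ Phase d S)
  pullback_id : ∀ d S, pullback d (Symmetry.Hom.id S) = AddMonoidHom.id _
  pullback_comp : ∀ (d : ℕ) {S T U : Symmetry.{u}} (f₂ : Symmetry.Hom T U) (f₁ : Symmetry.Hom S T),
    pullback d (f₂.comp f₁) = (pullback d f₁).comp (pullback d f₂)

attribute [instance] TopologicalPhases.stacking

namespace TopologicalPhases

/-- The abelian group of `d`-dimensional SPT phases with symmetry `S`: the topological phases that
are invertible under stacking. -/
abbrev SPT (P : TopologicalPhases) (d : ℕ) (S : Symmetry) : Type _ := AddUnits (P.Phase d S)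

/-- The homomorphism `f^* : SPT^d(G₂, φ₂) → SPT^d(G₁, φ₁)`. -/
def sptPullback (P : TopologicalPhases) (d : ℕ) {S T : Symmetry} (f : Symmetry.Hom S T) :
    P.SPT d T →+ P.SPT d S :=
  AddUnits.map (P.pullback d f)

/-- The generalized cohomology hypothesis, for all symmetry groups in the class `𝒢`: there is an
Ω-spectrum such that `SPT^d(G, φ) ≅ h^{φ+d}_G(pt)` for all `d ≥ 0` and all `(G, φ)`, by bijections
that respect addition and the maps induced by homomorphisms `(G₁, φ₁) → (G₂, φ₂)`. -/
def GeneralizedCohomologyHypothesis (𝒢 : Symmetry.{u} → Prop)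
    (P : TopologicalPhases.{u, w}) : Prop :=
  ∃ (F : OmegaSpectrum.{v})
    (e : ∀ (d : ℕ) (S : Symmetry.{u}), 𝒢 S → (P.SPT d S ≃+ PointCohomology F d S)),
    ∀ (d : ℕ) (S T : Symmetry.{u}) (hS : 𝒢 S) (hT : 𝒢 T) (f : Symmetry.Hom S T) (x : P.SPT d T),
      e d S hS (P.sptPullback d f x) = f.pullback F d (e d T hT x)

end TopologicalPhases

/-! ## Adding a further symmetry generator -/

/-- The symmetry group `G` inside `ℤ × G`, with the restricted orientation homomorphism. -/
abbrev Symmetry.restrict {G : Type*} [Group G] [TopologicalSpace G] [IsTopologicalGroup G]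
    (φ : Multiplicative ℤ × G →ₜ* ℤˣ) : Symmetry :=
  Symmetry.of (φ.comp (ContinuousMonoidHom.inr (Multiplicative ℤ) G))

/-- The inclusion `G → ℤ × G`. -/
def Symmetry.inclusion {G : Type*} [Group G] [TopologicalSpace G] [IsTopologicalGroup G]
    (φ : Multiplicative ℤ × G →ₜ* ℤˣ) : Symmetry.Hom (Symmetry.restrict φ) (Symmetry.of φ) :=
  ⟨ContinuousMonoidHom.inr (Multiplicative ℤ) G, fun _ => rfl⟩

end

noncomputable section

/-! ## Homotopies of maps of pairs -/

namespace PairMap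

variable {X : Type*} [TopologicalSpace X] {A : Set X} {Y : Type*} [TopologicalSpace Y] {y₀ : Y}

/-! Since `φ` is trivial on translations, `ℤ × G` acts on `Ĩ` through `G`, and `B(ℤ × G)` is `S¹ ×
BG` up to homotopy. Write `B = EG ×_G Ĩ` and `A` for its part over the endpoints. Then
`h^{φ+d}_{ℤ×G}(pt)` becomes `h^{d+1}(S¹ × B, S¹ × A)`, and forgetting translations becomes
restriction to the basepoint of `S¹`.

A class with trivial restriction comes from a family of based loops, i.e. a map `B → Ω F_{d+1} ≃
F_d` (`PairMap.exists_unloop_equiv`), and such a family is trivial as soon as it is freely trivial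
(`PairMap.equiv_const_of_unloop_equiv_const`). So the kernel is `h^d(B, A) = h^{φ+d-1}_G(pt)`. This
identification is additive by an Eckmann–Hilton argument (`Cohomology.unloop_transRep_equiv`).

The equivalence is explicit in Milnor's model. A weighted mean of the integer labels (`EG.height`),
together with the `G`-labels, maps `E(ℤ × G)` to `ℝ × EG`; `EG.spiral` goes back. Both composites
are equivariantly homotopic to the identity, because equivariant maps into Milnor's space are unique
up to homotopy (`EG.exists_homotopy_fst_snd`) and `ℝ` is convex. On quotients these maps become
`unwind` and `rewind`.

The splitting needs no cohomology: the projection `ℤ × G → G` preserves orientation characters, and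
pulling phases back along it is a section. Nor are group axioms needed for `Cohomology`: the
constant class is idempotent, so the given isomorphisms match it with zero. -/

theorem equiv_of_continuous {f g : PairMap X A Y y₀} (K : I × X → Y) (hK : Continuous K)
    (h₀ : ∀ x, K (0, x) = f.1 x) (h₁ : ∀ x, K (1, x) = g.1 x)
    (hA : ∀ t, ∀ a ∈ A, K (t, a) = y₀) : f ≈ g :=
  ⟨⟨⟨⟨K, hK⟩, h₀, h₁⟩, hA⟩⟩

theorem exists_of_equiv {f g : PairMap X A Y y₀} (h : f ≈ g) :
    ∃ K : I × X → Y, Continuous K ∧ (∀ x, K (0, x) = f.1 x) ∧ (∀ x, K (1, x) = g.1 x) ∧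
      ∀ t, ∀ a ∈ A, K (t, a) = y₀ := by
  obtain ⟨H⟩ := h
  exact ⟨H, H.continuous, fun x => H.apply_zero x, fun x => H.apply_one x,
    fun t a ha => H.prop' t a ha⟩

theorem equiv_of_eq {f g : PairMap X A Y y₀} (h : ∀ x, f.1 x = g.1 x) : f ≈ g := by
  have : f = g := Subtype.ext (ContinuousMap.ext h)
  rw [this]

/-- The constant map at the basepoint. -/
def const (X : Type*) [TopologicalSpace X] (A : Set X) {Y : Type*} [TopologicalSpace Y]
    (y₀ : Y) : PairMap X A Y y₀ :=
  ⟨ContinuousMap.const X y₀, fun _ _ => rfl⟩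

end PairMap

/-! ## Maps out of a product with a circle -/

theorem IsOpenQuotientMap.exists_lift {X Q Y : Type*} [TopologicalSpace X] [TopologicalSpace Q]
    [TopologicalSpace Y] {q : X → Q} (hq : IsOpenQuotientMap q) {f : X → Y} (hf : Continuous f)
    (h : ∀ x x', q x = q x' → f x = f x') : ∃ g : C(Q, Y), ∀ x, g (q x) = f x := by
  refine ⟨hq.isQuotientMap.lift (f := ⟨q, hq.continuous⟩) ⟨f, hf⟩ (fun x x' => h x x'), fun x => ?_⟩
  exact DFunLike.congr_fun (hq.isQuotientMap.lift_comp (f := ⟨q, hq.continuous⟩) ⟨f, hf⟩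
    (fun x x' => h x x')) x

/-- Openness matters: a product of a quotient map with an arbitrary space need not be a quotient
map, but open quotient maps are stable under products. -/
theorem isOpenQuotientMap_coe_prodMap (T : Type*) [TopologicalSpace T] :
    IsOpenQuotientMap (Prod.map ((↑) : ℝ → UnitAddCircle) (id : T → T)) :=
  IsOpenQuotientMap.prodMap QuotientAddGroup.isOpenQuotientMap_mk IsOpenQuotientMap.id

theorem UnitAddCircle.coe_eq_coe_iff {x y : ℝ} :
    (x : UnitAddCircle) = y ↔ ∃ n : ℤ, x = y + n := by
  rw [← sub_eq_zero, ← AddCircle.coe_sub, AddCircle.coe_eq_zero_iff]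
  refine exists_congr fun n => ?_
  rw [zsmul_eq_mul, mul_one, eq_sub_iff_add_eq, eq_comm, add_comm]

theorem UnitAddCircle.coe_add_intCast (x : ℝ) (n : ℤ) :
    ((x + n : ℝ) : UnitAddCircle) = x :=
  UnitAddCircle.coe_eq_coe_iff.2 ⟨n, rfl⟩

theorem UnitAddCircle.coe_one : ((1 : ℝ) : UnitAddCircle) = 0 :=
  AddCircle.coe_period 1

theorem UnitAddCircle.exists_coe_unitInterval (c : UnitAddCircle) :
    ∃ s : I, ((s : ℝ) : UnitAddCircle) = c := by
  induction c using QuotientAddGroup.induction_on with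
  | H r =>
    refine ⟨⟨Int.fract r, Int.fract_nonneg r, (Int.fract_lt_one r).le⟩, ?_⟩
    refine UnitAddCircle.coe_eq_coe_iff.2 ⟨-⌊r⌋, ?_⟩
    simp [Int.fract, sub_eq_add_neg]

section Circle

variable {T Y : Type*} [TopologicalSpace T] [TopologicalSpace Y]

theorem exists_circleLift {k : I × T → Y} (hk : Continuous k) (h : ∀ t, k (0, t) = k (1, t)) :
    ∃ K : C(UnitAddCircle × T, Y), ∀ (s : I) (t : T), K (((s : ℝ) : UnitAddCircle), t) = k (s, t) := by
  let k' : ℝ × T → Y := fun p => Set.IccExtend (zero_le_one' ℝ) (fun s => k (s, p.2)) (Int.fract p.1)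
  have hk' : Continuous k' := by
    refine (ContinuousOn.comp_fract' (f := fun t r => Set.IccExtend (zero_le_one' ℝ)
      (fun s => k (s, t)) r) ?_ ?_).comp continuous_swap
    · refine Continuous.continuousOn ?_
      change Continuous fun p : T × ℝ => k (Set.projIcc 0 1 _ p.2, p.1)
      fun_prop
    · intro t
      simpa using h t
  obtain ⟨K, hK⟩ := (isOpenQuotientMap_coe_prodMap T).exists_lift hk' (by
    rintro ⟨r, t⟩ ⟨r', t'⟩ hr
    obtain ⟨h₁, rfl⟩ := Prod.ext_iff.1 hr
    obtain ⟨n, rfl⟩ := UnitAddCircle.coe_eq_coe_iff.1 h₁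
    simp [k'])
  refine ⟨K, fun s t => (hK ((s : ℝ), t)).trans ?_⟩
  change k (Set.projIcc 0 1 _ (Int.fract (s : ℝ)), t) = _
  -- At `s = 1` the fractional part jumps back to `0`, and the agreement of the two ends is needed.
  rcases eq_or_lt_of_le s.2.2 with hs | hs
  · obtain rfl : s = 1 := Subtype.ext hs
    simpa using h t
  · rw [Int.fract_eq_self.2 ⟨s.2.1, hs⟩, Set.projIcc_val]

/-- The map out of `S¹ × T` determined by a map out of `[0, 1] × T` that agrees at the ends. -/
def circleLift (k : I × T → Y) (hk : Continuous k) (h : ∀ t, k (0, t) = k (1, t)) :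
    C(UnitAddCircle × T, Y) :=
  (exists_circleLift hk h).choose

theorem circleLift_coe {k : I × T → Y} (hk : Continuous k) (h : ∀ t, k (0, t) = k (1, t))
    (s : I) (t : T) : circleLift k hk h (((s : ℝ) : UnitAddCircle), t) = k (s, t) :=
  (exists_circleLift hk h).choose_spec s t

/-- Evaluation of a loop at a point of the circle. -/
def loopEval (y : Y) : C(UnitAddCircle × Path y y, Y) :=
  circleLift (fun p => p.2 p.1) (by fun_prop) (by simp)

theorem loopEval_coe (y : Y) (s : I) (γ : Path y y) :
    loopEval y (((s : ℝ) : UnitAddCircle), γ) = γ s :=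
  circleLift_coe _ _ s γ

theorem loopEval_zero (y : Y) (γ : Path y y) : loopEval y (0, γ) = y := by
  simpa using loopEval_coe y 0 γ

theorem loopEval_refl (y : Y) (c : UnitAddCircle) : loopEval y (c, Path.refl y) = y := by
  obtain ⟨s, rfl⟩ := c.exists_coe_unitInterval
  rw [loopEval_coe]; rfl

end Circle

/-! ### Families of based loops as maps out of a product with a circle -/

namespace PairMap

variable {B : Type*} [TopologicalSpace B] {A : Set B} {Y : Type*} [TopologicalSpace Y] {y₀ : Y}

/-- A homotopy between maps out of a product with a circle, given on `[0, 1]`. -/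
theorem equiv_of_continuous_circle {f g : PairMap (UnitAddCircle × B) (Set.univ ×ˢ A) Y y₀}
    (K : I × (I × B) → Y) (hK : Continuous K) (hends : ∀ t, K (0, t) = K (1, t))
    (h₀ : ∀ (s : I) b, K (s, (0, b)) = f.1 (((s : ℝ) : UnitAddCircle), b))
    (h₁ : ∀ (s : I) b, K (s, (1, b)) = g.1 (((s : ℝ) : UnitAddCircle), b))
    (hA : ∀ s t, ∀ a ∈ A, K (s, (t, a)) = y₀) : f ≈ g := by
  refine equiv_of_continuous (fun p => circleLift K hK hends (p.2.1, (p.1, p.2.2))) (by fun_prop)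
    ?_ ?_ ?_
  · rintro ⟨c, b⟩
    obtain ⟨s, rfl⟩ := c.exists_coe_unitInterval
    simp only [circleLift_coe, h₀]
  · rintro ⟨c, b⟩
    obtain ⟨s, rfl⟩ := c.exists_coe_unitInterval
    simp only [circleLift_coe, h₁]
  · rintro t ⟨c, b⟩ ⟨-, hb⟩
    obtain ⟨s, rfl⟩ := c.exists_coe_unitInterval
    simp only [circleLift_coe]
    exact hA s t b hb

/-- The map `S¹ × B → Y` adjoint to a map `B → Ω Y`. -/
def unloop (f : PairMap B A (Path y₀ y₀) (Path.refl y₀)) :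
    PairMap (UnitAddCircle × B) (Set.univ ×ˢ A) Y y₀ :=
  ⟨(loopEval y₀).comp ((ContinuousMap.id _).prodMap f.1), by
    rintro ⟨c, b⟩ ⟨-, hb⟩
    simp [f.2 b hb, loopEval_refl]⟩

theorem unloop_coe (f : PairMap B A (Path y₀ y₀) (Path.refl y₀)) (s : I) (b : B) :
    f.unloop.1 (((s : ℝ) : UnitAddCircle), b) = f.1 b s :=
  loopEval_coe _ _ _

theorem unloop_zero (f : PairMap B A (Path y₀ y₀) (Path.refl y₀)) (b : B) :
    f.unloop.1 (0, b) = y₀ :=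
  loopEval_zero _ _

theorem unloop_equiv {f g : PairMap B A (Path y₀ y₀) (Path.refl y₀)} (h : f ≈ g) :
    f.unloop ≈ g.unloop := by
  obtain ⟨K, hK, h₀, h₁, hA⟩ := exists_of_equiv h
  refine equiv_of_continuous_circle (fun p => K p.2 p.1) (by fun_prop) (by simp) ?_ ?_ ?_
  · intro s b; simp [unloop_coe, h₀]
  · intro s b; simp [unloop_coe, h₁]
  · intro s t a ha; simp [hA t a ha]

variable {Z : Type*} [TopologicalSpace Z] {z₀ : Z}

/-- Composition of a map of pairs with a pointed map. -/
def postcomp (u : C(Y, Z)) (hu : u y₀ = z₀) (f : PairMap B A Y y₀) : PairMap B A Z z₀ :=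
  ⟨u.comp f.1, fun a ha => by simp [f.2 a ha, hu]⟩

theorem postcomp_equiv (u : C(Y, Z)) (hu : u y₀ = z₀) {f g : PairMap B A Y y₀} (h : f ≈ g) :
    f.postcomp u hu ≈ g.postcomp u hu := by
  obtain ⟨K, hK, h₀, h₁, hA⟩ := exists_of_equiv h
  refine equiv_of_continuous (fun p => u (K p)) (by fun_prop) ?_ ?_ ?_
  · intro b; simp [postcomp, h₀]
  · intro b; simp [postcomp, h₁]
  · intro t a ha; simp [hA t a ha, hu]

theorem postcomp_equiv_of_homotopicRel {u v : C(Y, Z)} (hu : u y₀ = z₀) (hv : v y₀ = z₀)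
    (h : u.HomotopicRel v {y₀}) (f : PairMap B A Y y₀) : f.postcomp u hu ≈ f.postcomp v hv := by
  obtain ⟨H⟩ := h
  refine equiv_of_continuous (fun p => H (p.1, f.1 p.2)) (by fun_prop) ?_ ?_ ?_
  · intro b; simp [postcomp]
  · intro b; simp [postcomp]
  · intro t a ha; rw [f.2 a ha, H.eq_fst t rfl, hu]

end PairMap

/-! ## Reparametrization of loops -/

/-- The nearest point of the unit interval. -/
def clampI (r : ℝ) : I := Set.projIcc 0 1 zero_le_one r

@[fun_prop]
theorem continuous_clampI : Continuous clampI := continuous_projIcc (h := zero_le_one)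

theorem clampI_of_le_zero {r : ℝ} (h : r ≤ 0) : clampI r = 0 := Set.projIcc_of_le_left _ h

theorem clampI_of_one_le {r : ℝ} (h : 1 ≤ r) : clampI r = 1 := Set.projIcc_of_right_le _ h

theorem clampI_coe (s : I) : clampI s = s := Set.projIcc_val _ s

theorem clampI_of_mem {r : ℝ} (h : r ∈ I) : clampI r = ⟨r, h⟩ := Set.projIcc_of_mem _ h

/-- The parameter moves in a straight line from `a s` to `s`; the endpoint values of `a` keep every
intermediate path a loop, and clamping removes any need to bound `a`. -/
theorem Path.exists_homotopy_reparam {Y : Type*} [TopologicalSpace Y] (y : Y) (a : I → ℝ)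
    (ha : Continuous a) (ha₀ : a 0 = 0) (ha₁ : a 1 = 1) :
    ∃ K : I × Path y y → Path y y, Continuous K ∧ (∀ γ s, K (0, γ) s = γ (clampI (a s))) ∧
      (∀ γ, K (1, γ) = γ) ∧ ∀ t, K (t, Path.refl y) = Path.refl y := by
  let K : I × Path y y → Path y y := fun p =>
    { toFun := fun s => p.2 (clampI ((1 - p.1) * a s + p.1 * s))
      continuous_toFun := by fun_prop
      source' := by simp [ha₀, clampI_of_le_zero le_rfl]
      target' := by simp [ha₁, clampI_of_one_le le_rfl] }
  refine ⟨K, ?_, ?_, ?_, ?_⟩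
  · refine Path.continuous_uncurry_iff.1 ?_
    change Continuous fun p : (I × Path y y) × I =>
      p.1.2 (clampI ((1 - p.1.1) * a p.2 + p.1.1 * p.2))
    fun_prop
  · intro γ s
    change γ (clampI ((1 - (0 : I)) * a s + (0 : I) * s)) = _
    simp
  · intro γ
    ext s
    change γ (clampI ((1 - (1 : I)) * a s + (1 : I) * s)) = _
    simp [clampI_coe]
  · intro t
    rfl

theorem Path.trans_refl_apply {Y : Type*} [TopologicalSpace Y] {y : Y} (γ : Path y y) (s : I) :
    γ.trans (Path.refl y) s = γ (clampI (2 * s)) := by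
  rw [Path.trans_apply]
  split_ifs with h
  · rw [clampI_of_mem]
  · rw [clampI_of_one_le (by linarith)]; simp

theorem Path.refl_trans_apply {Y : Type*} [TopologicalSpace Y] {y : Y} (γ : Path y y) (s : I) :
    (Path.refl y).trans γ s = γ (clampI (2 * s - 1)) := by
  rw [Path.trans_apply]
  split_ifs with h
  · rw [clampI_of_le_zero (by linarith)]; simp
  · rw [clampI_of_mem]

/-- `Path.exists_homotopy_reparam` requires exact endpoint values, hence `min (2 * s) 1` rather than
`2 * s`; after clamping the two are the same. -/
theorem clampI_min_one (r : ℝ) : clampI (min r 1) = clampI r := by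
  rcases le_total r 1 with h | h
  · rw [min_eq_left h]
  · rw [min_eq_right h, clampI_of_one_le h, clampI_of_one_le le_rfl]

theorem clampI_max_zero (r : ℝ) : clampI (max r 0) = clampI r := by
  rcases le_total r 0 with h | h
  · rw [max_eq_right h, clampI_of_le_zero h, clampI_of_le_zero le_rfl]
  · rw [max_eq_left h]

namespace Cohomology

variable (F : OmegaSpectrum) (n : ℤ)

/-! ## The basepoint is a unit for addition up to homotopy -/

/-- A based deformation of the loop space to its identity is transported through `toLoop` and
`ofLoop`, then continued by the spectrum's own homotopy `ofLoop ∘ toLoop ≃ id`, all relative to the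
basepoint. -/
theorem exists_homotopy_ofLoop_toLoop (K : I × Path (F.pt (n + 1)) (F.pt (n + 1)) →
      Path (F.pt (n + 1)) (F.pt (n + 1))) (hK : Continuous K) (h₁ : ∀ γ, K (1, γ) = γ)
    (hrefl : ∀ t, K (t, Path.refl _) = Path.refl _) :
    ∃ U : I × F.space n → F.space n, Continuous U ∧
      (∀ x, U (0, x) = F.ofLoop n (K (0, F.toLoop n x))) ∧ (∀ x, U (1, x) = x) ∧
      ∀ t, U (t, F.pt n) = F.pt n := by
  have h : ContinuousMap.HomotopicRel (⟨fun x => F.ofLoop n (K (0, F.toLoop n x)), by fun_prop⟩ :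
      C(F.space n, F.space n)) ((F.ofLoop n).comp (F.toLoop n)) {F.pt n} :=
    ⟨{ toFun := fun p => F.ofLoop n (K (p.1, F.toLoop n p.2))
       continuous_toFun := by fun_prop
       map_zero_left := fun x => rfl
       map_one_left := fun x => by simp [h₁]
       prop' := by
        rintro t x rfl
        simp [F.toLoop_pt, hrefl] }⟩
  obtain ⟨U⟩ := h.trans (F.ofLoop_toLoop n)
  refine ⟨U, U.continuous, fun x => U.apply_zero x, fun x => U.apply_one x, fun t => ?_⟩
  exact U.eq_snd t rfl

/-- A loop followed by the constant loop is a reparametrization of that loop. -/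
theorem exists_homotopy_loopAdd_pt :
    ∃ U : I × F.space n → F.space n, Continuous U ∧ (∀ x, U (0, x) = loopAdd F n (x, F.pt n)) ∧
      (∀ x, U (1, x) = x) ∧ ∀ t, U (t, F.pt n) = F.pt n := by
  obtain ⟨K, hK, h₀, h₁, hr⟩ := Path.exists_homotopy_reparam (F.pt (n + 1))
    (fun s => min (2 * s : ℝ) 1) (by fun_prop) (by simp) (by norm_num)
  obtain ⟨U, hU, hU₀, hU₁, hU₂⟩ := exists_homotopy_ofLoop_toLoop F n K hK h₁ hr
  refine ⟨U, hU, fun x => ?_, hU₁, hU₂⟩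
  rw [hU₀]
  change _ = F.ofLoop n ((F.toLoop n x).trans (F.toLoop n (F.pt n)))
  rw [F.toLoop_pt]
  congr 1
  ext s
  rw [h₀, Path.trans_refl_apply, clampI_min_one]

theorem exists_homotopy_pt_loopAdd :
    ∃ U : I × F.space n → F.space n, Continuous U ∧ (∀ x, U (0, x) = loopAdd F n (F.pt n, x)) ∧
      (∀ x, U (1, x) = x) ∧ ∀ t, U (t, F.pt n) = F.pt n := by
  obtain ⟨K, hK, h₀, h₁, hr⟩ := Path.exists_homotopy_reparam (F.pt (n + 1))
    (fun s => max (2 * s - 1 : ℝ) 0) (by fun_prop) (by simp) (by norm_num)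
  obtain ⟨U, hU, hU₀, hU₁, hU₂⟩ := exists_homotopy_ofLoop_toLoop F n K hK h₁ hr
  refine ⟨U, hU, fun x => ?_, hU₁, hU₂⟩
  rw [hU₀]
  change _ = F.ofLoop n ((F.toLoop n (F.pt n)).trans (F.toLoop n x))
  rw [F.toLoop_pt]
  congr 1
  ext s
  rw [h₀, Path.refl_trans_apply, clampI_max_zero]

/-! ## The suspension homomorphism -/

variable {B : Type*} [TopologicalSpace B] {A : Set B}

/-- Pointwise concatenation of maps into a loop space. -/
def transRep {Y : Type*} [TopologicalSpace Y] {y : Y}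
    (f g : PairMap B A (Path y y) (Path.refl y)) : PairMap B A (Path y y) (Path.refl y) :=
  ⟨⟨fun b => (f.1 b).trans (g.1 b), Path.continuous_trans.comp
    (f.1.continuous.prodMk g.1.continuous)⟩, fun a ha => by simp [f.2 a ha, g.2 a ha]⟩

/-- Concatenating loops in `F n` agrees with adding them pointwise. -/
theorem unloop_transRep_equiv
    (f g : PairMap B A (Path (F.pt n) (F.pt n)) (Path.refl (F.pt n))) :
    (transRep f g).unloop ≈ addRep F n f.unloop g.unloop := by
  obtain ⟨U, hU, hU₀, hU₁, hU₂⟩ := exists_homotopy_loopAdd_pt F n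
  obtain ⟨V, hV, hV₀, hV₁, hV₂⟩ := exists_homotopy_pt_loopAdd F n
  -- the sum of `f`, delayed on the second half, and `g`, delayed on the first half
  let m : PairMap (UnitAddCircle × B) (Set.univ ×ˢ A) (F.space n) (F.pt n) :=
    ⟨circleLift (fun p => loopAdd F n (f.1 p.2 (clampI (2 * p.1)), g.1 p.2 (clampI (2 * p.1 - 1))))
      (by fun_prop) (by
        intro b
        simp [clampI_of_le_zero, clampI_of_one_le, show (2 : ℝ) - 1 = 1 by norm_num]), by
      rintro ⟨c, b⟩ ⟨-, hb⟩
      obtain ⟨s, rfl⟩ := c.exists_coe_unitInterval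
      simp [circleLift_coe, f.2 b hb, g.2 b hb, loopAdd_pt]⟩
  have hm : ∀ (s : I) b, m.1 (((s : ℝ) : UnitAddCircle), b) =
      loopAdd F n (f.1 b (clampI (2 * s)), g.1 b (clampI (2 * s - 1))) := fun s b =>
    circleLift_coe _ _ s b
  -- Eckmann–Hilton, first half: `m` is `f + pt` on the first half of the circle and `pt + g` on the
  -- second, so the unit homotopies `U` and `V` turn it into the concatenation. They agree at `s =
  -- 1/2`, where both loops are at the basepoint, because `U` and `V` fix that point.
  have h₁ : (transRep f g).unloop ≈ m := by
    refine Setoid.symm (PairMap.equiv_of_continuous_circle (fun p => if (p.1 : ℝ) ≤ 1 / 2 then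
      U (p.2.1, f.1 p.2.2 (clampI (2 * p.1))) else V (p.2.1, g.1 p.2.2 (clampI (2 * p.1 - 1))))
      ?_ ?_ ?_ ?_ ?_)
    · refine Continuous.if_le (by fun_prop) (by fun_prop) (by fun_prop) (by fun_prop) ?_
      rintro ⟨s, t, b⟩ (hs : (s : ℝ) = 1 / 2)
      simp [hs, clampI_of_le_zero, clampI_of_one_le, hU₂, hV₂]
    · rintro ⟨t, b⟩
      have h2 : ¬ (1 : ℝ) ≤ 1 / 2 := by norm_num
      have h3 : (2 : ℝ) - 1 = 1 := by norm_num
      simp only [Set.Icc.coe_one, Set.Icc.coe_zero, if_neg h2]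
      simp [clampI_of_le_zero, clampI_of_one_le, hU₂, hV₂, h3]
    · intro s b
      rw [hm]
      split_ifs with hs
      · simp only at hs
        rw [hU₀, clampI_of_le_zero (r := 2 * s - 1) (by linarith), Path.source]
      · simp only at hs
        rw [hV₀, clampI_of_one_le (r := 2 * s) (by linarith), Path.target]
    · intro s b
      rw [PairMap.unloop_coe]
      change _ = (f.1 b).trans (g.1 b) s
      rw [Path.trans_apply]
      split_ifs with hs
      · simp only [hU₁]; rw [clampI_of_mem]
      · simp only [hV₁]; rw [clampI_of_mem]
    · intro s t a ha
      simp [f.2 a ha, g.2 a ha, hU₂, hV₂]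
  -- Second half: the two delays are undone by straight-line changes of parameter, carried out
  -- simultaneously in both summands.
  have h₂ : m ≈ addRep F n f.unloop g.unloop := by
    refine PairMap.equiv_of_continuous_circle (fun p => loopAdd F n
      (f.1 p.2.2 (clampI ((1 - p.2.1) * min (2 * (p.1 : ℝ)) 1 + p.2.1 * p.1)),
        g.1 p.2.2 (clampI ((1 - p.2.1) * max (2 * (p.1 : ℝ) - 1) 0 + p.2.1 * p.1))))
      (by fun_prop) ?_ ?_ ?_ ?_
    · rintro ⟨t, b⟩
      have h3 : (2 : ℝ) - 1 = 1 := by norm_num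
      simp [clampI_of_le_zero, clampI_of_one_le, h3]
    · intro s b
      simp [hm, clampI_min_one, clampI_max_zero]
    · intro s b
      simp [addRep, PairMap.unloop_coe, clampI_coe]
    · intro s t a ha
      simp [f.2 a ha, g.2 a ha, loopAdd_pt]
  exact Setoid.trans h₁ h₂

/-- The map `S¹ × B → F (n + 1)` adjoint to the composite `B → F n → Ω F (n + 1)`. -/
def suspensionRep (f : PairMap B A (F.space n) (F.pt n)) :
    PairMap (UnitAddCircle × B) (Set.univ ×ˢ A) (F.space (n + 1)) (F.pt (n + 1)) :=
  (f.postcomp (F.toLoop n) (F.toLoop_pt n)).unloop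

/-- The homomorphism `hⁿ(B, A) → hⁿ⁺¹(S¹ × B, S¹ × A)`. -/
def suspension : Cohomology F n B A → Cohomology F (n + 1) (UnitAddCircle × B) (Set.univ ×ˢ A) :=
  Quotient.map (suspensionRep F n) fun _ _ h =>
    PairMap.unloop_equiv (PairMap.postcomp_equiv _ _ h)

theorem postcomp_toLoop_ofLoop_equiv
    (f : PairMap B A (Path (F.pt (n + 1)) (F.pt (n + 1))) (Path.refl (F.pt (n + 1)))) :
    (f.postcomp (F.ofLoop n) (F.ofLoop_refl n)).postcomp (F.toLoop n) (F.toLoop_pt n) ≈ f :=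
  Setoid.trans (PairMap.equiv_of_eq fun _ => rfl) (Setoid.trans
    (PairMap.postcomp_equiv_of_homotopicRel (u := (F.toLoop n).comp (F.ofLoop n))
      (v := ContinuousMap.id _) (z₀ := Path.refl _)
      ((congrArg (F.toLoop n) (F.ofLoop_refl n)).trans (F.toLoop_pt n)) rfl (F.toLoop_ofLoop n) f)
    (PairMap.equiv_of_eq fun _ => rfl))

theorem postcomp_ofLoop_toLoop_equiv (f : PairMap B A (F.space n) (F.pt n)) :
    (f.postcomp (F.toLoop n) (F.toLoop_pt n)).postcomp (F.ofLoop n) (F.ofLoop_refl n) ≈ f :=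
  Setoid.trans (PairMap.equiv_of_eq fun _ => rfl) (Setoid.trans
    (PairMap.postcomp_equiv_of_homotopicRel (u := (F.ofLoop n).comp (F.toLoop n))
      (v := ContinuousMap.id _) (z₀ := F.pt n)
      (by simp [F.ofLoop_refl, F.toLoop_pt]) rfl (F.ofLoop_toLoop n) f)
    (PairMap.equiv_of_eq fun _ => rfl))

/-- The sum in degree `n` is `ofLoop` of a concatenation, so `toLoop` returns the concatenation
along the new circle up to homotopy. The sum in degree `n + 1` instead uses loops one level higher
in the spectrum; `unloop_transRep_equiv` reconciles the two directions. -/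
theorem suspension_add (x y : Cohomology F n B A) :
    suspension F n (x + y) = suspension F n x + suspension F n y := by
  induction x using Quotient.inductionOn with | _ f
  induction y using Quotient.inductionOn with | _ g
  refine Quotient.sound (Setoid.trans ?_ (unloop_transRep_equiv F (n + 1)
    (f.postcomp (F.toLoop n) (F.toLoop_pt n)) (g.postcomp (F.toLoop n) (F.toLoop_pt n))))
  exact PairMap.unloop_equiv (postcomp_toLoop_ofLoop_equiv F n (transRep
    (f.postcomp (F.toLoop n) (F.toLoop_pt n)) (g.postcomp (F.toLoop n) (F.toLoop_pt n))))


/-- The constant class, which is the neutral element of `hⁿ(X, A)`. -/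
def const (X : Type*) [TopologicalSpace X] (A : Set X) : Cohomology F n X A :=
  Quotient.mk _ (PairMap.const X A (F.pt n))

/-- Idempotence is all that is needed to recognize the neutral element once an additive bijection
with a group is available. -/
theorem const_add_const (X : Type*) [TopologicalSpace X] (A : Set X) :
    const F n X A + const F n X A = const F n X A :=
  Quotient.sound (PairMap.equiv_of_eq fun _ => loopAdd_pt F n)

/-- The inclusion of `B` into `S¹ × B` at the basepoint of the circle. -/
def atZero (B : Type*) [TopologicalSpace B] : C(B, UnitAddCircle × B) :=
  ⟨fun b => (0, b), by fun_prop⟩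

theorem pullback_atZero_suspension (x : Cohomology F n B A) :
    pullback F (n + 1) (atZero B) (A' := Set.univ ×ˢ A) (fun _ h => ⟨trivial, h⟩)
      (suspension F n x) = const F (n + 1) B A := by
  induction x using Quotient.inductionOn with | _ f
  exact Quotient.sound (PairMap.equiv_of_eq fun b => PairMap.unloop_zero _ b)

/-- A based family of loops that is freely null-homotopic is null-homotopic through based
loops. -/
theorem _root_.PairMap.equiv_const_of_unloop_equiv_const {Y : Type*} [TopologicalSpace Y] {y : Y}
    (f : PairMap B A (Path y y) (Path.refl y)) (h : f.unloop ≈ PairMap.const _ _ y) :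
    f ≈ PairMap.const B A (Path.refl y) := by
  obtain ⟨H, hH, h₀, h₁, hA⟩ := PairMap.exists_of_equiv h
  replace hA : ∀ t c, ∀ b ∈ A, H (t, (c, b)) = y := fun t c b hb => hA t (c, b) ⟨trivial, hb⟩
  replace h₁ : ∀ p, H (1, p) = y := h₁
  have hz : ∀ b, H (0, (0, b)) = y := fun b => by rw [h₀, PairMap.unloop_zero]
  -- height of the path around the other three sides of a square
  let trap : ℝ → ℝ := fun s => min 1 (min (3 * s) (3 - 3 * s))
  have htrap : Continuous trap := by fun_prop
  have ht₀ : trap 0 = 0 := by norm_num [trap]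
  have ht₁ : trap 1 = 0 := by norm_num [trap]
  have hc₁ : clampI (3 - 1) = 1 := clampI_of_one_le (by norm_num)
  let m : PairMap B A (Path y y) (Path.refl y) :=
    ⟨⟨fun b => ⟨⟨fun s => H (clampI (trap s), (0, b)), by fun_prop⟩,
      by simp [ht₀, clampI_of_le_zero, hz], by simp [ht₁, clampI_of_le_zero, hz]⟩,
      Path.continuous_uncurry_iff.1 (by
        change Continuous fun p : B × I => H (clampI (trap p.2), (0, p.1))
        fun_prop)⟩, fun a ha => by ext s; exact hA _ _ a ha⟩
  -- During `H` the basepoint of the circle may wander, so `H` is not itself a based homotopy. Its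
  -- bottom edge, the loop `f b`, is pushed across the square to the path up one side, along the top
  -- and down the other side. `H` equals `y` on the top, so the circle coordinate may be replaced by
  -- `0` there; the two sides coincide in the circle, and this gives `m`.
  have e₁ : f ≈ m := by
    refine PairMap.equiv_of_continuous (fun p => ⟨⟨fun s => H (clampI (p.1 * trap s),
      (((1 - p.1) * s + p.1 * clampI (3 * s - 1) : ℝ), p.2)), by fun_prop⟩, ?_, ?_⟩) ?_ ?_ ?_ ?_
    · simp [ht₀, clampI_of_le_zero, hz]
    · simp [ht₁, clampI_of_le_zero, hc₁, UnitAddCircle.coe_one, hz]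
    · refine Path.continuous_uncurry_iff.1 ?_
      change Continuous fun p : (I × B) × I => H (clampI (p.1.1 * trap p.2),
        (((1 - p.1.1) * p.2 + p.1.1 * clampI (3 * p.2 - 1) : ℝ), p.1.2))
      fun_prop
    · intro b
      ext s
      change H (clampI ((0 : I) * trap s),
        (((1 - (0 : I)) * s + (0 : I) * clampI (3 * s - 1) : ℝ), b)) = _
      simp [clampI_of_le_zero, h₀, PairMap.unloop_coe]
    · intro b
      ext s
      change H (clampI ((1 : I) * trap s),
        (((1 - (1 : I)) * s + (1 : I) * clampI (3 * s - 1) : ℝ), b)) = H (clampI (trap s), (0, b))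
      simp only [Set.Icc.coe_one, one_mul, sub_self, zero_mul, zero_add]
      rcases le_total (3 * s - 1 : ℝ) 0 with hs | hs
      · simp [clampI_of_le_zero hs]
      rcases le_total 1 (3 * s - 1 : ℝ) with hs' | hs'
      · simp [clampI_of_one_le hs', UnitAddCircle.coe_one]
      · rw [clampI_of_one_le (r := trap s) (le_min le_rfl (le_min (by linarith) (by linarith))),
          h₁, h₁]
    · intro t a ha
      ext s
      exact hA _ _ a ha
  -- `m` runs up and back along the same path, so scaling down the height contracts it while keeping
  -- its ends at `y`.
  have e₂ : m ≈ PairMap.const B A (Path.refl y) := by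
    refine PairMap.equiv_of_continuous (fun p => ⟨⟨fun s => H (clampI ((1 - p.1) * trap s),
      (0, p.2)), by fun_prop⟩, ?_, ?_⟩) ?_ ?_ ?_ ?_
    · simp [ht₀, clampI_of_le_zero, hz]
    · simp [ht₁, clampI_of_le_zero, hz]
    · refine Path.continuous_uncurry_iff.1 ?_
      change Continuous fun p : (I × B) × I => H (clampI ((1 - p.1.1) * trap p.2), (0, p.1.2))
      fun_prop
    · intro b
      ext s
      change H (clampI ((1 - (0 : I)) * trap s), (0, b)) = H (clampI (trap s), (0, b))
      simp
    · intro b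
      ext s
      change H (clampI ((1 - (1 : I)) * trap s), (0, b)) = y
      simp [clampI_of_le_zero, hz]
    · intro t a ha
      ext s
      exact hA _ _ a ha
  exact Setoid.trans e₁ e₂

theorem eq_const_of_suspension_eq_const (x : Cohomology F n B A)
    (h : suspension F n x = const F (n + 1) _ _) : x = const F n B A := by
  induction x using Quotient.inductionOn with | _ f
  have h' := PairMap.equiv_const_of_unloop_equiv_const _ (Quotient.exact h)
  refine Quotient.sound (Setoid.trans (Setoid.symm (postcomp_ofLoop_toLoop_equiv F n f))
    (Setoid.trans (PairMap.postcomp_equiv (F.ofLoop n) (F.ofLoop_refl n) h') ?_))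
  exact PairMap.equiv_of_eq fun b => F.ofLoop_refl n

/-- A map out of `S¹ × B` whose restriction to `B` is null-homotopic is homotopic to a based
family of loops. -/
theorem _root_.PairMap.exists_unloop_equiv {Y : Type*} [TopologicalSpace Y] {y : Y}
    (g : PairMap (UnitAddCircle × B) (Set.univ ×ˢ A) Y y) {N : I × B → Y} (hN : Continuous N)
    (h₀ : ∀ b, N (0, b) = g.1 (0, b)) (h₁ : ∀ b, N (1, b) = y) (hA : ∀ t, ∀ b ∈ A, N (t, b) = y) :
    ∃ f : PairMap B A (Path y y) (Path.refl y), f.unloop ≈ g := by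
  classical
  have hg : ∀ c, ∀ b ∈ A, g.1 (c, b) = y := fun c b hb => g.2 _ ⟨trivial, hb⟩
  -- the concatenation of the reverse of `N`, of `g`, and of `N`, on `[-1, 2]`
  let E : ℝ × B → Y := fun p => if p.1 ≤ 0 then N (clampI (-p.1), p.2) else
    if p.1 ≤ 1 then g.1 ((p.1 : UnitAddCircle), p.2) else N (clampI (p.1 - 1), p.2)
  have hcoe : Continuous fun r : ℝ => (r : UnitAddCircle) := AddCircle.continuous_mk' 1
  have hE : Continuous E := by
    have hg' : Continuous fun p : ℝ × B => g.1 ((p.1 : UnitAddCircle), p.2) :=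
      g.1.continuous.comp ((hcoe.comp continuous_fst).prodMk continuous_snd)
    refine Continuous.if_le (by fun_prop) (Continuous.if_le hg' (by fun_prop) (by fun_prop)
      (by fun_prop) ?_) (by fun_prop) (by fun_prop) ?_
    · rintro ⟨r, b⟩ (rfl : r = 1)
      simp [UnitAddCircle.coe_one, clampI_of_le_zero, h₀]
    · rintro ⟨r, b⟩ (rfl : r = 0)
      simp [clampI_of_le_zero, h₀]
  have hE₀ : ∀ (t : I) b, E (-t, b) = N (t, b) := fun t b => by
    have : -(t : ℝ) ≤ 0 := by simpa using t.2.1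
    simp [E, this, clampI_coe]
  have hE₁ : ∀ (t : I) b, E (1 + t, b) = N (t, b) := fun t b => by
    have ht := t.2.1
    have h2 : ¬ (1 + t : ℝ) ≤ 0 := by linarith
    rcases ht.eq_or_lt with h | h
    · obtain rfl : t = 0 := Subtype.ext h.symm
      simp [E, UnitAddCircle.coe_one, h₀, show ¬ (1 : ℝ) ≤ 0 by norm_num]
    · simp [E, h2, clampI_coe, h.not_ge]
  have hEs : ∀ (s : I) b, E (s, b) = g.1 (((s : ℝ) : UnitAddCircle), b) := fun s b => by
    rcases s.2.1.eq_or_lt with h | h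
    · obtain rfl : s = 0 := Subtype.ext h.symm
      simp [E, clampI_of_le_zero, h₀]
    · simp [E, h.not_ge, s.2.2]
  have hEA : ∀ r, ∀ b ∈ A, E (r, b) = y := fun r b hb => by
    simp only [E]
    split_ifs <;> simp [hA _ b hb, hg _ b hb]
  let f : PairMap B A (Path y y) (Path.refl y) :=
    ⟨⟨fun b => ⟨⟨fun s => E (-1 + 3 * s, b), by fun_prop⟩,
      by have := hE₀ 1 b; simp_all, by have := hE₁ 1 b; norm_num at this ⊢; simp_all⟩,
      Path.continuous_uncurry_iff.1 (by
        change Continuous fun p : B × I => E (-1 + 3 * p.2, p.1)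
        fun_prop)⟩, fun a ha => by ext s; exact hEA _ a ha⟩
  -- The window `[-t, 1 + t]` grows from `[0, 1]`, where `E` is `g`, to `[-1, 2]`. At each time both
  -- of its ends have the value `N (t, b)`, so the intermediate maps descend to the circle.
  refine ⟨f, Setoid.symm (PairMap.equiv_of_continuous_circle
    (fun p => E (-p.2.1 + (1 + 2 * p.2.1) * p.1, p.2.2)) (by fun_prop) ?_ ?_ ?_ ?_)⟩
  · rintro ⟨t, b⟩
    have h3 : (-t + (1 + 2 * t) : ℝ) = 1 + t := by ring
    simp [hE₀, h3, hE₁]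
  · intro s b
    simp [hEs]
  · intro s b
    rw [PairMap.unloop_coe]
    change _ = E (-1 + 3 * s, b)
    norm_num
  · intro s t a ha
    exact hEA _ a ha

theorem exists_suspension_eq (z : Cohomology F (n + 1) (UnitAddCircle × B) (Set.univ ×ˢ A))
    (h : pullback F (n + 1) (atZero B) (A := A) (A' := Set.univ ×ˢ A) (fun _ h => ⟨trivial, h⟩) z =
      const F (n + 1) B A) : ∃ x : Cohomology F n B A, suspension F n x = z := by
  induction z using Quotient.inductionOn with | _ g
  obtain ⟨N, hN, h₀, h₁, hA⟩ := PairMap.exists_of_equiv (Quotient.exact h)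
  obtain ⟨f, hf⟩ := PairMap.exists_unloop_equiv g hN h₀ h₁ hA
  exact ⟨Quotient.mk _ (f.postcomp (F.ofLoop n) (F.ofLoop_refl n)), Quotient.sound
    (Setoid.trans (PairMap.unloop_equiv (postcomp_toLoop_ofLoop_equiv F n f)) hf)⟩

end Cohomology

/-! ## Maps into and homotopies of Milnor's `EG` -/

theorem hasSum_interleave {f₀ f₁ : ℕ → ℝ} {a b : ℝ} (h₀ : HasSum f₀ a) (h₁ : HasSum f₁ b) :
    HasSum (fun p => if p % 2 = 0 then f₀ (p / 2) else f₁ (p / 2)) (a + b) := by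
  refine HasSum.even_add_odd ?_ ?_
  · simpa using h₀
  · have h : ∀ k, (2 * k + 1) / 2 = k := fun k => by omega
    have h' : ∀ k, ¬ (2 * k + 1) % 2 = 0 := fun k => by omega
    simpa only [h, h', if_false] using h₁

theorem Set.Finite.half_mem {s : Set ℕ} (hs : s.Finite) : {p : ℕ | p / 2 ∈ s}.Finite := by
  refine ((hs.image (2 * ·)).union (hs.image (2 * · + 1))).subset fun p hp => ?_
  rcases Nat.mod_two_eq_zero_or_one p with h | h
  · exact Or.inl ⟨p / 2, hp, by simp only; omega⟩
  · exact Or.inr ⟨p / 2, hp, by simp only; omega⟩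

namespace EG

variable {G : Type*} [Group G]

theorem hasSum (e : EG G) : HasSum e.t 1 := by
  have h := (summable_of_hasFiniteSupport (L := .unconditional ℕ) e.t_finite).hasSum
  rwa [tsum_eq_finsum e.t_finite, e.t_sum] at h

open scoped Classical in
/-- The point of `EG` with given weights and labels. -/
def ofLabels (t : ℕ → ℝ) (l : ℕ → G) (h₀ : ∀ i, 0 ≤ t i) (hf : t.support.Finite)
    (hs : HasSum t 1) : EG G where
  t := t
  g i := if t i = 0 then 1 else l i
  t_nonneg := h₀
  t_finite := hf
  t_sum := by rw [← tsum_eq_finsum (L := .unconditional ℕ) hf, hs.tsum_eq]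
  g_eq_one i hi := if_pos hi

section ofLabels

variable {t t' : ℕ → ℝ} {l l' : ℕ → G} {h₀ : ∀ i, 0 ≤ t i} {hf : t.support.Finite}
    {hs : HasSum t 1} {h₀' : ∀ i, 0 ≤ t' i} {hf' : t'.support.Finite} {hs' : HasSum t' 1}

theorem ofLabels_eq {e : EG G} (ht : ∀ i, t i = e.t i) (hl : ∀ i, e.t i ≠ 0 → l i = e.g i) :
    ofLabels t l h₀ hf hs = e := by
  ext i
  · exact ht i
  · change (if t i = 0 then 1 else l i) = e.g i
    split_ifs with h
    · exact (e.g_eq_one i (by rw [← ht, h])).symm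
    · exact hl i (by rwa [← ht])

theorem ofLabels_eq_smul (h : G) (ht : ∀ i, t i = t' i) (hl : ∀ i, t' i ≠ 0 → l i = h * l' i) :
    ofLabels t l h₀ hf hs = h • ofLabels t' l' h₀' hf' hs' := by
  refine ofLabels_eq ht fun i hi => ?_
  have hi' : t' i ≠ 0 := hi
  have hi'' : (ofLabels t' l' h₀' hf' hs').t i ≠ 0 := hi
  rw [hl i hi', smul_g, if_neg hi'']
  change h * l' i = h * if t' i = 0 then 1 else l' i
  rw [if_neg hi']

theorem ofLabels_congr (ht : ∀ i, t i = t' i) (hl : ∀ i, t' i ≠ 0 → l i = l' i) :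
    ofLabels t l h₀ hf hs = ofLabels t' l' h₀' hf' hs' := by
  rw [ofLabels_eq_smul 1 ht (by simpa using hl), one_smul]

end ofLabels

theorem continuous_t [TopologicalSpace G] (i : ℕ) : Continuous fun e : EG G => e.t i :=
  ⟨fun U hU => TopologicalSpace.isOpen_generateFrom_of_mem (Or.inl ⟨i, U, hU, rfl⟩)⟩

theorem continuousAt_g [TopologicalSpace G] {i : ℕ} {e : EG G} (h : e.t i ≠ 0) :
    ContinuousAt (fun e : EG G => e.g i) e := by
  rw [continuousAt_def]
  intro V hV
  obtain ⟨W, hWV, hW, hm⟩ := mem_nhds_iff.1 hV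
  refine mem_nhds_iff.2 ⟨{x : EG G | x.t i ≠ 0 ∧ x.g i ∈ W}, fun x hx => hWV hx.2,
    TopologicalSpace.isOpen_generateFrom_of_mem (Or.inr ⟨i, W, hW, rfl⟩), h, hm⟩

/-- In the coarse topology a label is tested only where its weight is nonzero. Jumps of labels in
the constructions below are harmless because the weight vanishes there. -/
theorem continuous_of_labels [TopologicalSpace G] {X : Type*} [TopologicalSpace X] {f : X → EG G}
    (ht : ∀ i, Continuous fun x => (f x).t i)
    (hg : ∀ i x, (f x).t i ≠ 0 → ContinuousAt (fun x => (f x).g i) x) : Continuous f := by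
  refine continuous_generateFrom_iff.2 ?_
  rintro s (⟨i, U, hU, rfl⟩ | ⟨i, V, hV, rfl⟩)
  · exact hU.preimage (ht i)
  · refine isOpen_iff_mem_nhds.2 fun x hx => ?_
    exact Filter.inter_mem ((ht i).continuousAt.eventually_ne hx.1)
      (hg i x hx.1 (hV.mem_nhds hx.2))

theorem continuous_ofLabels [TopologicalSpace G] {X : Type*} [TopologicalSpace X] {t : X → ℕ → ℝ} {l : X → ℕ → G}
    {h₀ : ∀ x i, 0 ≤ t x i} {hf : ∀ x, (t x).support.Finite} {hs : ∀ x, HasSum (t x) 1}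
    (ht : ∀ i, Continuous fun x => t x i)
    (hl : ∀ i x, t x i ≠ 0 → ContinuousAt (fun x => l x i) x) :
    Continuous fun x => ofLabels (t x) (l x) (h₀ x) (hf x) (hs x) := by
  refine continuous_of_labels ht fun i x hx => ?_
  refine (hl i x hx).congr ?_
  filter_upwards [(ht i).continuousAt.eventually_ne hx] with y hy
  exact (if_neg hy).symm

instance [TopologicalSpace G] [IsTopologicalGroup G] : ContinuousConstSMul G (EG G) where
  continuous_const_smul h := by
    refine continuous_of_labels continuous_t fun i x hx => ?_
    have hx' : x.t i ≠ 0 := hx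
    refine (continuousAt_const.mul (continuousAt_g hx') :
      ContinuousAt (fun x : EG G => h * x.g i) x).congr ?_
    filter_upwards [(continuous_t i).continuousAt.eventually_ne hx] with y hy
    exact (if_neg hy).symm

/-! ### Interleaving -/

/-- The join of two points of `EH`, with new labels: the first one in the even positions, and the
second one in the odd positions. -/
def interleave {H : Type*} [Group H] (τ : I) (x y : EG H) (l₀ l₁ : ℕ → G) : EG G :=
  ofLabels (fun p => if p % 2 = 0 then (1 - τ) * x.t (p / 2) else τ * y.t (p / 2))
    (fun p => if p % 2 = 0 then l₀ (p / 2) else l₁ (p / 2))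
    (fun p => by
      have := x.t_nonneg (p / 2)
      have := y.t_nonneg (p / 2)
      have := τ.2.1
      have := sub_nonneg.2 τ.2.2
      split_ifs <;> positivity)
    ((x.t_finite.union y.t_finite).half_mem.subset fun p hp => by
      by_contra h
      have h' : x.t (p / 2) = 0 ∧ y.t (p / 2) = 0 := by
        simpa [Set.mem_union, not_or, not_not] using h
      exact hp (by simp [h'.1, h'.2]))
    (by
      have := hasSum_interleave (x.hasSum.mul_left (1 - τ : ℝ)) (y.hasSum.mul_left (τ : ℝ))
      convert this using 1
      ring)

theorem continuous_interleave [TopologicalSpace G] {H : Type*} [Group H] [TopologicalSpace H] {X : Type*}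
    [TopologicalSpace X] {τ : X → I} {x y : X → EG H} {l₀ l₁ : X → ℕ → G} (hτ : Continuous τ)
    (hx : Continuous x) (hy : Continuous y)
    (hl₀ : ∀ i z, (τ z : ℝ) ≠ 1 → (x z).t i ≠ 0 → ContinuousAt (fun z => l₀ z i) z)
    (hl₁ : ∀ i z, (τ z : ℝ) ≠ 0 → (y z).t i ≠ 0 → ContinuousAt (fun z => l₁ z i) z) :
    Continuous fun z => interleave (τ z) (x z) (y z) (l₀ z) (l₁ z) := by
  refine continuous_ofLabels (fun p => ?_) fun p z hz => ?_
  · have := (continuous_t (p / 2)).comp hx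
    have := (continuous_t (p / 2)).comp hy
    simp only [Function.comp_def] at *
    split_ifs <;> fun_prop
  · split_ifs at hz ⊢ with h
    · exact hl₀ _ z (fun h1 => hz (by simp [h1])) (right_ne_zero_of_mul hz)
    · exact hl₁ _ z (left_ne_zero_of_mul hz) (right_ne_zero_of_mul hz)

theorem smul_interleave {H : Type*} [Group H] (τ : I) {x y x' y' : EG H} {l₀ l₁ l₀' l₁' : ℕ → G}
    (h : G) (hx : ∀ i, x'.t i = x.t i) (hy : ∀ i, y'.t i = y.t i)
    (hl₀ : ∀ i, (τ : ℝ) ≠ 1 → x.t i ≠ 0 → l₀' i = h * l₀ i)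
    (hl₁ : ∀ i, (τ : ℝ) ≠ 0 → y.t i ≠ 0 → l₁' i = h * l₁ i) :
    interleave τ x' y' l₀' l₁' = h • interleave τ x y l₀ l₁ := by
  refine ofLabels_eq_smul h (fun p => by simp only [hx, hy]) fun p hp => ?_
  split_ifs at hp ⊢ with h
  · exact hl₀ _ (fun h1 => hp (by simp [h1])) (right_ne_zero_of_mul hp)
  · exact hl₁ _ (left_ne_zero_of_mul hp) (right_ne_zero_of_mul hp)

/-! ### Any two equivariant maps into `EG` are equivariantly homotopic -/

/-- A continuous function of `τ ∈ [0, 1]` that rises from `0` to `1` on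
`[p / (p + 1), (p + 1) / (p + 2)]`. -/
def ramp (p : ℕ) (τ : I) : I := clampI ((p + 1) * (p + 2) * τ - p * (p + 2))

@[fun_prop]
theorem continuous_ramp (p : ℕ) : Continuous (ramp p) := by
  unfold ramp; fun_prop

theorem ramp_zero (p : ℕ) : ramp p 0 = 0 :=
  clampI_of_le_zero (by simp; positivity)

theorem ramp_one (p : ℕ) : ramp p 1 = 1 :=
  clampI_of_one_le (by simp; nlinarith)

/-- The rising intervals of successive ramps are adjacent, so every earlier move is finished before
the move with index `p` begins. -/
theorem ramp_eq_one {p q : ℕ} (h : q < p) {τ : I} (hp : ramp p τ ≠ 0) : ramp q τ = 1 := by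
  have h₁ : (p * (p + 2) : ℝ) < (p + 1) * (p + 2) * τ := by
    by_contra hc
    exact hp (clampI_of_le_zero (by linarith))
  have h₂ : (p : ℝ) < (p + 1) * τ := by nlinarith
  have h₃ : (q + 1 : ℝ) ≤ p := by exact_mod_cast h
  have h₄ := τ.2.2
  have h₅ : (q + 1 : ℝ) ≤ (q + 2) * τ := by nlinarith
  exact clampI_of_one_le (by nlinarith)

/-- A homotopy on `EG` that moves `t i • g i` from position `2 * i + δ` (at time `0`) to position
`i` (at time `1`), for `i = 0, 1, 2, …` in turn. -/
def shift (δ : Fin 2) (τ : I) (e : EG G) : EG G :=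
  ofLabels (fun p => ramp p τ * e.t p +
      if p % 2 = (δ : ℕ) then (1 - ramp (p / 2) τ) * e.t (p / 2) else 0)
    (fun p => if ramp p τ ≠ 0 then e.g p else e.g (p / 2))
    (fun p => by
      have := e.t_nonneg p
      have := e.t_nonneg (p / 2)
      have := (ramp p τ).2.1
      have := sub_nonneg.2 (ramp (p / 2) τ).2.2
      split_ifs <;> positivity)
    ((e.t_finite.union e.t_finite.half_mem).subset fun p hp => by
      by_contra h
      have h' : e.t p = 0 ∧ e.t (p / 2) = 0 := by
        simpa [Set.mem_union, not_or, not_not] using h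
      exact hp (by simp [h'.1, h'.2]))
    (by
      have h₁ : Summable fun p => ramp p τ * e.t p :=
        summable_of_hasFiniteSupport (e.t_finite.subset fun p hp => right_ne_zero_of_mul hp)
      have h₂ : HasSum (fun p => (1 - ramp p τ) * e.t p) (1 - ∑' p, ramp p τ * e.t p) := by
        have := e.hasSum.sub h₁.hasSum
        simpa only [one_mul, sub_mul] using this
      -- The weight that has not yet moved sits in the positions of parity `δ`; together with the
      -- moved weight it gives the original total.
      have h₃ : HasSum (fun p : ℕ => if p % 2 = (δ : ℕ) then (1 - ramp (p / 2) τ) * e.t (p / 2) else 0)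
          (1 - ∑' p, ramp p τ * e.t p) := by
        fin_cases δ
        · have := hasSum_interleave h₂ hasSum_zero
          simpa using this
        · have := hasSum_interleave hasSum_zero h₂
          rw [zero_add] at this
          convert this using 2 with p
          rcases Nat.mod_two_eq_zero_or_one p with h | h <;> simp [h]
      have := h₁.hasSum.add h₃
      rwa [add_sub_cancel] at this)

theorem shift_one (δ : Fin 2) (e : EG G) : shift δ 1 e = e :=
  ofLabels_eq (by simp [ramp_one]) (by simp [ramp_one])

theorem smul_shift (δ : Fin 2) (τ : I) (h : G) (e : EG G) : shift δ τ (h • e) = h • shift δ τ e := by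
  refine ofLabels_eq_smul h (fun p => rfl) fun p hp => ?_
  split_ifs with hr
  · rw [smul_g, if_neg]
    intro h0
    rcases Nat.eq_zero_or_pos p with rfl | hpos
    · simp [h0] at hp
    · simp [h0, ramp_eq_one (Nat.div_lt_self hpos one_lt_two) hr] at hp
  · rw [not_not] at hr
    rw [smul_g, if_neg]
    intro h0
    simp [h0, hr] at hp

theorem continuous_shift [TopologicalSpace G] (δ : Fin 2) : Continuous fun p : I × EG G => shift δ p.1 p.2 := by
  refine continuous_ofLabels (fun p => ?_) fun p z hz => ?_
  · have := continuous_t (G := G) p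
    have := continuous_t (G := G) (p / 2)
    split_ifs <;> fun_prop
  · have hg : ∀ {i}, z.2.t i ≠ 0 → ContinuousAt (fun z : I × EG G => z.2.g i) z := fun h =>
      ContinuousAt.comp (f := Prod.snd) (continuousAt_g h) continuousAt_snd
    -- Position `0` is its own half, so both candidate labels coincide there and no ordering of
    -- ramps is needed.
    rcases Nat.eq_zero_or_pos p with rfl | hpos
    · simp only [Nat.zero_div, ite_self]
      exact hg fun h0 => hz (by simp [h0])
    have hlt := Nat.div_lt_self hpos one_lt_two
    have hc : ∀ p, ContinuousAt (fun z : I × EG G => ramp p z.1) z := fun p => by fun_prop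
    -- If `ramp p` vanishes, a nonzero weight forces `ramp (p / 2) ≠ 1`; this persists nearby and
    -- keeps `ramp p` zero, so the label does not switch. Otherwise the old occupant of position `p`
    -- has already left.
    by_cases hr : ramp p z.1 = 0
    · have h1 : ramp (p / 2) z.1 ≠ 1 := fun h1 => hz (by simp [hr, h1])
      refine (hg (i := p / 2) fun h0 => hz (by simp [h0, hr])).congr ?_
      filter_upwards [(hc (p / 2)).eventually_ne h1] with y hy
      rw [if_neg]
      exact fun h => hy (ramp_eq_one hlt h)
    · refine (hg (i := p) fun h0 => hz (by simp [h0, ramp_eq_one hlt hr])).congr ?_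
      filter_upwards [(hc p).eventually_ne hr] with y hy
      rw [if_pos hy]

theorem continuous_shift_comp [TopologicalSpace G] {X : Type*} [TopologicalSpace X] (δ : Fin 2)
    {τ : X → I} {e : X → EG G} (hτ : Continuous τ) (he : Continuous e) :
    Continuous fun x => shift δ (τ x) (e x) :=
  (continuous_shift δ).comp (hτ.prodMk he)

/-- At ramp time `0` nothing has moved yet, so `shift 0 0` is exactly the spread over even
positions. -/
theorem interleave_zero (x y : EG G) : interleave 0 x y x.g y.g = shift 0 0 x := by
  refine ofLabels_congr (fun p => ?_) fun p hp => ?_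
  · simp [ramp_zero]
  · have h : p % 2 = 0 := by
      by_contra h
      exact hp (by simp [ramp_zero, h])
    simp [ramp_zero, h]

theorem interleave_one (x y : EG G) : interleave 1 x y x.g y.g = shift 1 0 y := by
  refine ofLabels_congr (fun p => ?_) fun p hp => ?_
  · rcases Nat.mod_two_eq_zero_or_one p with h | h <;> simp [ramp_zero, h]
  · have h : p % 2 = 1 := by
      by_contra h
      exact hp (by simp [ramp_zero, h])
    simp [ramp_zero, h]

/-- The two projections `EG × EG → EG` are equivariantly homotopic. -/
theorem exists_homotopy_fst_snd (G : Type*) [Group G] [TopologicalSpace G] :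
    ∃ Ψ : I × (EG G × EG G) → EG G, Continuous Ψ ∧ (∀ a b, Ψ (0, (a, b)) = a) ∧
      (∀ a b, Ψ (1, (a, b)) = b) ∧ ∀ t (h : G) a b, Ψ (t, (h • a, h • b)) = h • Ψ (t, (a, b)) := by
  let P : C(EG G × EG G, EG G) → Prop := fun k => ∀ (h : G) a b, k (h • a, h • b) = h • k (a, b)
  have hshift : ∀ (δ : Fin 2) (f : C(EG G × EG G, EG G)), P f → ContinuousMap.HomotopicWith
      (⟨fun p => shift δ 0 (f p), continuous_shift_comp δ (by fun_prop) (by fun_prop)⟩ :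
        C(EG G × EG G, EG G)) f P := fun δ f hf =>
    ⟨{ toFun := fun p => shift δ p.1 (f p.2)
       continuous_toFun := continuous_shift_comp δ (by fun_prop) (by fun_prop)
       map_zero_left := fun p => rfl
       map_one_left := fun p => shift_one δ _
       prop' := fun t h a b => by
        change shift δ t (f (h • a, h • b)) = h • shift δ t (f (a, b))
        rw [hf, smul_shift] }⟩
  -- With `a` in the even positions and `b` in the odd ones, the weights can be shifted linearly
  -- from one to the other without ever comparing labels. The shifts then remove the gaps at both
  -- ends.
  have hjoin : ContinuousMap.HomotopicWith
      (⟨fun p => shift 0 0 p.1, continuous_shift_comp 0 (by fun_prop) (by fun_prop)⟩ : C(EG G × EG G, EG G))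
      ⟨fun p => shift 1 0 p.2, continuous_shift_comp 1 (by fun_prop) (by fun_prop)⟩ P :=
    ⟨{ toFun := fun p => interleave p.1 p.2.1 p.2.2 p.2.1.g p.2.2.g
       continuous_toFun := continuous_interleave (by fun_prop) (by fun_prop) (by fun_prop)
        (fun i z _ h => ContinuousAt.comp (f := fun z : I × (EG G × EG G) => z.2.1)
          (g := fun e : EG G => e.g i) (continuousAt_g h) (by fun_prop))
        (fun i z _ h => ContinuousAt.comp (f := fun z : I × (EG G × EG G) => z.2.2)
          (g := fun e : EG G => e.g i) (continuousAt_g h) (by fun_prop))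
       map_zero_left := fun p => interleave_zero _ _
       map_one_left := fun p => interleave_one _ _
       prop' := fun t h a b => smul_interleave t h (fun _ => rfl) (fun _ => rfl)
        (fun i _ hi => by simp [smul_g, hi]) (fun i _ hi => by simp [smul_g, hi]) }⟩
  obtain ⟨H⟩ := ((hshift 0 ⟨Prod.fst, continuous_fst⟩ fun _ _ _ => rfl).symm.trans hjoin).trans
    (hshift 1 ⟨Prod.snd, continuous_snd⟩ fun _ _ _ => rfl)
  exact ⟨H, H.continuous, fun a b => H.apply_zero (a, b), fun a b => H.apply_one (a, b),
    fun t h a b => H.prop' t h a b⟩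

end EG

/-! ## An equivariant map from `E(ℤ × G)` to the real line -/

namespace EG

variable {G : Type*} [Group G]

/-- A continuous function on `EG` whose support is contained in `{t i > 0}`; for varying `i`, these
supports are locally finite, and no point of `EG` lies outside all of them. -/
def cutoff (i : ℕ) (e : EG G) : ℝ :=
  max 0 (min (e.t i - (1 / 2) ^ (i + 2)) (3 / 4 - ∑ j ∈ Finset.range i, e.t j))

theorem cutoff_nonneg (i : ℕ) (e : EG G) : 0 ≤ cutoff i e := le_max_left _ _

theorem cutoff_eq_zero_of_t {i : ℕ} {e : EG G} (h : e.t i ≤ (1 / 2) ^ (i + 2)) :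
    cutoff i e = 0 :=
  max_eq_left ((min_le_left _ _).trans (sub_nonpos.2 h))

theorem cutoff_eq_zero_of_sum {i : ℕ} {e : EG G} (h : 3 / 4 ≤ ∑ j ∈ Finset.range i, e.t j) :
    cutoff i e = 0 :=
  max_eq_left ((min_le_right _ _).trans (sub_nonpos.2 h))

theorem t_ne_zero_of_cutoff {i : ℕ} {e : EG G} (h : cutoff i e ≠ 0) : e.t i ≠ 0 := fun h0 =>
  h (cutoff_eq_zero_of_t (by rw [h0]; positivity))

theorem cutoff_smul (i : ℕ) (h : G) (e : EG G) : cutoff i (h • e) = cutoff i e := rfl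

/-- If all cutoffs vanished, the partial sums would by induction stay below `1/2`, so the second
term of the minimum would be positive and `e.t N ≤ (1/2) ^ (N + 2)` for all `N`. The total weight
would then be at most `1/2` instead of `1`. -/
theorem exists_cutoff_pos (e : EG G) : ∃ i, 0 < cutoff i e := by
  by_contra! hc
  have hN : ∀ N, ∑ j ∈ Finset.range N, e.t j ≤ 1 / 2 - (1 / 2) ^ (N + 1) := by
    intro N
    induction N with
    | zero => norm_num
    | succ N ih =>
      have h₁ := (le_max_right _ _).trans (hc N)
      have h₂ : (0 : ℝ) < (1 / 2) ^ (N + 1) := by positivity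
      have h₃ : e.t N ≤ (1 / 2) ^ (N + 2) := by
        rcases min_le_iff.1 h₁ with h | h <;> linarith
      rw [Finset.sum_range_succ]
      have h₄ : ((1 : ℝ) / 2) ^ (N + 1) = 2 * (1 / 2) ^ (N + 2) := by ring
      linarith
  have := le_of_tendsto' e.hasSum.tendsto_sum_nat fun N =>
    (hN N).trans (sub_le_self (1 / 2 : ℝ) (by positivity))
  norm_num at this

theorem finite_support_cutoff (e : EG G) : (Function.support fun i => cutoff i e).Finite :=
  e.t_finite.subset fun _ h => t_ne_zero_of_cutoff h

theorem finsum_cutoff_pos (e : EG G) : 0 < ∑ᶠ i, cutoff i e := by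
  obtain ⟨i, hi⟩ := e.exists_cutoff_pos
  exact hi.trans_le (single_le_finsum i e.finite_support_cutoff fun j => cutoff_nonneg j e)

/-- A weighted mean of the values of `l` on the labels. -/
def mean (l : G → ℝ) (e : EG G) : ℝ := (∑ᶠ i, cutoff i e * l (e.g i)) / ∑ᶠ i, cutoff i e

/-- The cutoffs depend only on the weights, which the action preserves, and a mean of values all
shifted by `c` is shifted by `c`. -/
theorem mean_smul {l : G → ℝ} {h : G} {c : ℝ} (hl : ∀ g, l (h * g) = c + l g) (e : EG G) :
    mean l (h • e) = c + mean l e := by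
  have h₁ : ∀ i, cutoff i (h • e) * l ((h • e).g i) =
      c * cutoff i e + cutoff i e * l (e.g i) := by
    intro i
    rw [cutoff_smul]
    by_cases hi : cutoff i e = 0
    · simp [hi]
    · rw [smul_g, if_neg (t_ne_zero_of_cutoff hi), hl]
      ring
  have hf : ∀ f : ℕ → ℝ, (Function.support fun i => cutoff i e * f i).Finite := fun f =>
    e.finite_support_cutoff.subset fun _ hi => left_ne_zero_of_mul hi
  have h₂ := e.finsum_cutoff_pos.ne'
  simp only [mean, h₁]
  simp only [cutoff_smul]
  have h₃ : (Function.support fun i => c * cutoff i e).Finite := by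
    simpa only [mul_comm] using hf fun _ => c
  rw [finsum_add_distrib h₃ (hf _), ← mul_finsum, add_div, mul_div_cancel_right₀ _ h₂]

theorem mean_eq_zero {l : G → ℝ} {e : EG G} (h : ∀ i, l (e.g i) = 0) : mean l e = 0 := by
  simp [mean, h]

theorem continuous_sum_t [TopologicalSpace G] (N : ℕ) : Continuous fun e : EG G => ∑ j ∈ Finset.range N, e.t j :=
  continuous_finsetSum _ fun j _ => continuous_t j

theorem continuous_cutoff [TopologicalSpace G] (i : ℕ) : Continuous fun e : EG G => cutoff i e := by
  have h₁ := continuous_t (G := G) i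
  have h₂ := continuous_sum_t (G := G) i
  unfold cutoff
  fun_prop

/-- Some partial sum of weights exceeds `3/4` at `e`, hence also nearby, and this switches off all
later cutoffs. The raw weights have no such local finiteness, which is why `mean` does not use them.
-/
theorem locallyFinite_cutoff [TopologicalSpace G] (f : ℕ → EG G → ℝ) (hf : ∀ i e, cutoff i e = 0 → f i e = 0) :
    LocallyFinite fun i => Function.support (f i) := by
  intro e
  obtain ⟨N, hN⟩ := (e.hasSum.tendsto_sum_nat.eventually
    (lt_mem_nhds (by norm_num : (3 / 4 : ℝ) < 1))).exists
  refine ⟨_, (continuous_sum_t N).continuousAt.eventually (lt_mem_nhds hN),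
    (Set.finite_Iio N).subset ?_⟩
  rintro i ⟨x, hx, hx'⟩
  by_contra hi
  refine hx (hf i x (cutoff_eq_zero_of_sum (le_of_lt (lt_of_lt_of_le hx' ?_))))
  exact Finset.sum_le_sum_of_subset_of_nonneg (Finset.range_mono (not_lt.1 hi))
    fun j _ _ => x.t_nonneg j

theorem continuous_mean [TopologicalSpace G] {l : G → ℝ} (hl : Continuous l) : Continuous (mean l) := by
  refine Continuous.div (continuous_finsum (fun i => ?_) ?_) (continuous_finsum continuous_cutoff ?_)
    fun e => e.finsum_cutoff_pos.ne'
  · refine continuous_iff_continuousAt.2 fun e => ?_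
    -- Where the weight is zero the label may be discontinuous, but the positive threshold in
    -- `cutoff` makes the whole term vanish in a neighbourhood.
    by_cases h : e.t i = 0
    · have : e.t i < (1 / 2) ^ (i + 2) := by rw [h]; positivity
      refine (continuousAt_const (y := (0 : ℝ))).congr ?_
      filter_upwards [(continuous_t i).continuousAt.eventually (gt_mem_nhds this)] with x hx
      rw [cutoff_eq_zero_of_t hx.le, zero_mul]
    · exact (continuous_cutoff i).continuousAt.mul
        (ContinuousAt.comp (f := fun e : EG G => e.g i) hl.continuousAt (continuousAt_g h))
  · exact locallyFinite_cutoff _ fun i e h => by rw [h, zero_mul]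
  · exact locallyFinite_cutoff _ fun i e h => h

/-- The `ℤ`-equivariant map `E(ℤ × G) → ℝ`. -/
def height : EG (Multiplicative ℤ × G) → ℝ := mean fun h => ((Multiplicative.toAdd h.1 : ℤ) : ℝ)

theorem continuous_height [TopologicalSpace G] : Continuous (height (G := G)) := by
  refine continuous_mean ?_
  have : Continuous fun n : Multiplicative ℤ => ((Multiplicative.toAdd n : ℤ) : ℝ) :=
    continuous_of_discreteTopology
  exact this.comp continuous_fst

theorem height_smul (h : Multiplicative ℤ × G) (e : EG (Multiplicative ℤ × G)) :
    height (h • e) = (Multiplicative.toAdd h.1 : ℤ) + height e :=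
  mean_smul (fun g => by push_cast [Prod.fst_mul, toAdd_mul]; rfl) e

/-- All integer labels are `0` here. This makes the inclusion of `G` land exactly at the basepoint
of the circle, not merely up to homotopy. -/
theorem height_map_inr (e : EG G) :
    height (EG.map (MonoidHom.inr (Multiplicative ℤ) G) e) = 0 :=
  mean_eq_zero fun i => by simp [EG.map]

end EG

/-! ## An equivariant map from `ℝ × EG` to `E(ℤ × G)` -/

theorem continuousAt_floor_of_ne {x : ℝ} (h : x ≠ ⌊x⌋) : ContinuousAt (Int.floor : ℝ → ℤ) x := by
  have h₁ : (⌊x⌋ : ℝ) < x := lt_of_le_of_ne (Int.floor_le x) h.symm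
  refine (continuousAt_const (y := ⌊x⌋)).congr ?_
  filter_upwards [Ioo_mem_nhds h₁ (Int.lt_floor_add_one x)] with y hy
  exact (Int.floor_eq_iff.2 ⟨hy.1.le, hy.2⟩).symm

/-- Twice the distance to the nearest integer. -/
def sawtooth (r : ℝ) : I :=
  ⟨2 * ‖(r : UnitAddCircle)‖, by positivity, by
    rw [UnitAddCircle.norm_eq]
    linarith [abs_sub_round r]⟩

theorem continuous_sawtooth : Continuous sawtooth := by
  have : Continuous fun r : ℝ => (r : UnitAddCircle) := AddCircle.continuous_mk' 1
  exact Continuous.subtype_mk (by fun_prop) _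

theorem sawtooth_add_intCast (r : ℝ) (n : ℤ) : sawtooth (r + n) = sawtooth r :=
  Subtype.ext (by simp only [sawtooth, UnitAddCircle.coe_add_intCast])

/-- The floor jumps at integers, where `sawtooth` is `0`; rounding jumps at half-integers, where it
is `1`. In `spiral` each label therefore jumps only when its copy of `e` has weight zero. -/
theorem continuousAt_floor_of_sawtooth {r : ℝ} (h : (sawtooth r : ℝ) ≠ 0) :
    ContinuousAt (Int.floor : ℝ → ℤ) r := by
  refine continuousAt_floor_of_ne fun hr => h ?_
  have : (r : UnitAddCircle) = ((0 : ℝ) : UnitAddCircle) :=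
    UnitAddCircle.coe_eq_coe_iff.2 ⟨⌊r⌋, by rwa [zero_add]⟩
  simp [sawtooth, this]

theorem continuousAt_round_of_sawtooth {r : ℝ} (h : (sawtooth r : ℝ) ≠ 1) :
    ContinuousAt (round : ℝ → ℤ) r := by
  have h₁ : ContinuousAt (Int.floor : ℝ → ℤ) (r + 1 / 2) := by
    refine continuousAt_floor_of_ne fun hr => h ?_
    rw [← round_eq] at hr
    simp only [sawtooth, UnitAddCircle.norm_eq]
    rw [show r - round r = -(1 / 2) by linarith]
    norm_num
  have h₂ : (round : ℝ → ℤ) = fun r => ⌊r + 1 / 2⌋ := funext round_eq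
  rw [h₂]
  exact ContinuousAt.comp (f := fun r : ℝ => r + 1 / 2) h₁ (by fun_prop)

namespace EG

variable {G : Type*} [Group G]

/-- The `(ℤ × G)`-equivariant map `ℝ × EG → E(ℤ × G)`. -/
def spiral (r : ℝ) (e : EG G) : EG (Multiplicative ℤ × G) :=
  interleave (sawtooth r) e e (fun i => (Multiplicative.ofAdd (round r), e.g i))
    (fun i => (Multiplicative.ofAdd ⌊r⌋, e.g i))

theorem spiral_smul (r : ℝ) (h : Multiplicative ℤ × G) (e : EG G) :
    spiral (r + Multiplicative.toAdd h.1) (h.2 • e) = h • spiral r e := by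
  simp only [spiral, sawtooth_add_intCast, round_add_intCast, Int.floor_add_intCast]
  refine smul_interleave _ h (fun _ => rfl) (fun _ => rfl) (fun i _ hi => ?_) fun i _ hi => ?_
  all_goals
    rw [smul_g, if_neg hi]
    refine Prod.ext ?_ rfl
    simp [mul_comm]

theorem continuous_spiral [TopologicalSpace G] {X : Type*} [TopologicalSpace X] {r : X → ℝ}
    {e : X → EG G} (hr : Continuous r) (he : Continuous e) :
    Continuous fun x => spiral (r x) (e x) := by
  have h : ∀ (i : ℕ) (x : X), (e x).t i ≠ 0 → ContinuousAt (fun x => (e x).g i) x := fun i x hx =>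
    ContinuousAt.comp (g := fun e : EG G => e.g i) (continuousAt_g hx) he.continuousAt
  have hZ : Continuous (Multiplicative.ofAdd : ℤ → Multiplicative ℤ) := continuous_ofAdd
  refine continuous_interleave (continuous_sawtooth.comp hr) he he (fun i x hx hi => ?_)
    fun i x hx hi => ?_
  · exact (hZ.continuousAt.comp (ContinuousAt.comp (continuousAt_round_of_sawtooth hx)
      hr.continuousAt)).prodMk (h i x hi)
  · exact (hZ.continuousAt.comp (ContinuousAt.comp (continuousAt_floor_of_sawtooth hx)
      hr.continuousAt)).prodMk (h i x hi)

end EG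

/-! ## Homotopy invariance -/

theorem IsOpenQuotientMap.exists_lift_homotopy {X Q Y : Type*} [TopologicalSpace X]
    [TopologicalSpace Q] [TopologicalSpace Y] {q : X → Q} (hq : IsOpenQuotientMap q)
    {f : I × X → Y} (hf : Continuous f) (h : ∀ t x x', q x = q x' → f (t, x) = f (t, x')) :
    ∃ g : C(I × Q, Y), ∀ t x, g (t, q x) = f (t, x) := by
  obtain ⟨g, hg⟩ := (IsOpenQuotientMap.prodMap (IsOpenQuotientMap.id (X := I)) hq).exists_lift hf
    (by
      rintro ⟨t, x⟩ ⟨t', x'⟩ hx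
      obtain ⟨rfl, hx⟩ := Prod.ext_iff.1 hx
      exact h t x x' hx)
  exact ⟨g, fun t x => hg (t, x)⟩

namespace Cohomology

variable (F : OmegaSpectrum) (n : ℤ) {X X' X'' : Type*} [TopologicalSpace X]
  [TopologicalSpace X'] [TopologicalSpace X''] {A : Set X} {A' : Set X'} {A'' : Set X''}

theorem pullback_pullback (f : C(X, X')) (hf : ∀ a ∈ A, f a ∈ A') (g : C(X', X''))
    (hg : ∀ a ∈ A', g a ∈ A'') (x : Cohomology F n X'' A'') :
    pullback F n f hf (pullback F n g hg x) =
      pullback F n (g.comp f) (fun a ha => hg _ (hf a ha)) x := by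
  induction x using Quotient.inductionOn with | _ k
  rfl

theorem pullback_eq_of_homotopy {f g : C(X, X')} (hf : ∀ a ∈ A, f a ∈ A')
    (hg : ∀ a ∈ A, g a ∈ A') (H : C(I × X, X')) (h₀ : ∀ x, H (0, x) = f x)
    (h₁ : ∀ x, H (1, x) = g x) (hA : ∀ t, ∀ a ∈ A, H (t, a) ∈ A') (x : Cohomology F n X' A') :
    pullback F n f hf x = pullback F n g hg x := by
  induction x using Quotient.inductionOn with | _ k
  refine Quotient.sound (PairMap.equiv_of_continuous (fun p => k.1 (H p)) (by fun_prop) ?_ ?_ ?_)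
  · intro x; rw [h₀]; rfl
  · intro x; rw [h₁]; rfl
  · intro t a ha; exact k.2 _ (hA t a ha)

theorem pullback_id (h : ∀ a ∈ A, ContinuousMap.id X a ∈ A) (x : Cohomology F n X A) :
    pullback F n (ContinuousMap.id X) h x = x := by
  induction x using Quotient.inductionOn with | _ k
  rfl

theorem pullback_add (f : C(X, X')) (hf : ∀ a ∈ A, f a ∈ A') (x y : Cohomology F n X' A') :
    pullback F n f hf (x + y) = pullback F n f hf x + pullback F n f hf y := by
  induction x using Quotient.inductionOn with | _ k
  induction y using Quotient.inductionOn with | _ l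
  rfl

end Cohomology

/-! ## The Borel construction of a product with `ℤ` -/

namespace TwistedInterval

variable {G : Type*} [Group G] [TopologicalSpace G] (φ : G →ₜ* ℤˣ)

instance : ContinuousConstSMul G (TwistedInterval φ) where
  continuous_const_smul g := by
    refine Continuous.subtype_mk (p := (· ∈ I)) ?_ _
    have : Continuous fun x : TwistedInterval φ => x.val := continuous_subtype_val
    fun_prop

end TwistedInterval

/-- The subset of `EG ×_G (pt × Ĩ)` that lies over the endpoints of `Ĩ`. -/
abbrev borelBoundary {G : Type*} [Group G] [TopologicalSpace G] (φ : G →ₜ* ℤˣ) :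
    Set (BorelConstruction G (PUnit.{1} × TwistedInterval φ)) :=
  borelSubset G (∅ ×ˢ Set.univ ∪ Set.univ ×ˢ TwistedInterval.boundary φ)

/-- The projection onto `EG ×_G (pt × Ĩ)`. -/
def borelMk {G : Type*} [Group G] [TopologicalSpace G] (φ : G →ₜ* ℤˣ)
    (x : EG G × (PUnit.{1} × TwistedInterval φ)) :
    BorelConstruction G (PUnit.{1} × TwistedInterval φ) :=
  Quotient.mk _ x

section borelMk

variable {G : Type*} [Group G] [TopologicalSpace G] (φ : G →ₜ* ℤˣ)

theorem isOpenQuotientMap_borelMk [IsTopologicalGroup G] : IsOpenQuotientMap (borelMk φ) := by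
  have : ContinuousConstSMul G PUnit.{1} := ⟨fun _ => continuous_const⟩
  exact MulAction.isOpenQuotientMap_quotientMk

theorem borelMk_smul (g : G) (x : EG G × (PUnit.{1} × TwistedInterval φ)) :
    borelMk φ (g • x) = borelMk φ x :=
  Quotient.sound ⟨g, rfl⟩

theorem exists_smul_of_borelMk_eq {x y : EG G × (PUnit.{1} × TwistedInterval φ)}
    (h : borelMk φ x = borelMk φ y) : ∃ g : G, x = g • y := by
  obtain ⟨g, hg⟩ := Quotient.exact h
  exact ⟨g, hg.symm⟩

theorem borelMk_mem {e : EG G} {u : PUnit.{1}} {x : TwistedInterval φ}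
    (h : x ∈ TwistedInterval.boundary φ) : borelMk φ (e, (u, x)) ∈ borelBoundary φ :=
  ⟨e, (u, x), Or.inr ⟨trivial, h⟩, rfl⟩

theorem exists_of_mem_borelBoundary {b : BorelConstruction G (PUnit.{1} × TwistedInterval φ)}
    (h : b ∈ borelBoundary φ) :
    ∃ (e : EG G) (u : PUnit.{1}) (x : TwistedInterval φ), x ∈ TwistedInterval.boundary φ ∧
      b = borelMk φ (e, (u, x)) := by
  obtain ⟨e, ⟨u, x⟩, h | h, rfl⟩ := h
  · exact absurd h.1 (Set.notMem_empty _)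
  · exact ⟨e, u, x, h.2, rfl⟩

end borelMk

/-! ### Comparison with a circle times the Borel construction of `G` -/

section Translation

variable {G : Type*} [Group G] [TopologicalSpace G] (φ : Multiplicative ℤ × G →ₜ* ℤˣ)

/-- The restriction of `φ` to `G`. -/
abbrev restrictHom : G →ₜ* ℤˣ := φ.comp (ContinuousMonoidHom.inr (Multiplicative ℤ) G)

variable {φ}

/-- This is how the hypothesis that the generator is a pure translation enters: it makes the action
on `Ĩ` factor through `G`. -/
theorem restrictHom_snd (hφ : φ (Multiplicative.ofAdd 1, 1) = 1) (h : Multiplicative ℤ × G) :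
    restrictHom φ h.2 = φ h := by
  have h₁ : h = (Multiplicative.ofAdd 1, 1) ^ (Multiplicative.toAdd h.1) * (1, h.2) := by
    refine Prod.ext ?_ ?_
    · simp [← ofAdd_zsmul]
    · simp
  conv_rhs => rw [h₁, map_mul, map_zpow, hφ, one_zpow, one_mul]
  rfl

variable (φ) in
/-- Forgetting the translations, on `E(ℤ × G) × (pt × Ĩ)`. -/
def flatten (x : EG (Multiplicative ℤ × G) × (PUnit.{1} × TwistedInterval φ)) :
    EG G × (PUnit.{1} × TwistedInterval (restrictHom φ)) :=
  (EG.map (MonoidHom.snd _ _) x.1, (x.2.1, (x.2.2 : I)))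

variable (φ) in
/-- The map `ℝ × (EG × (pt × Ĩ)) → E(ℤ × G) × (pt × Ĩ)`. -/
def coil (p : ℝ × (EG G × (PUnit.{1} × TwistedInterval (restrictHom φ)))) :
    EG (Multiplicative ℤ × G) × (PUnit.{1} × TwistedInterval φ) :=
  (EG.spiral p.1 p.2.1, (p.2.2.1, (p.2.2.2 : I)))

theorem continuous_flatten : Continuous (flatten φ) := by
  refine Continuous.prodMk ((EG.continuous_map _ continuous_snd).comp continuous_fst) ?_
  exact Continuous.prodMk (continuous_fst.comp continuous_snd) (continuous_snd.comp continuous_snd)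

theorem continuous_coil : Continuous (coil φ) := by
  have h₂ : Continuous fun p : ℝ × (EG G × (PUnit.{1} × TwistedInterval (restrictHom φ))) =>
      EG.spiral p.1 p.2.1 := EG.continuous_spiral (by fun_prop) (by fun_prop)
  have h₃ : Continuous fun p : ℝ × (EG G × (PUnit.{1} × TwistedInterval (restrictHom φ))) =>
      (p.2.2.1, p.2.2.2) := by fun_prop
  exact h₂.prodMk h₃

theorem flatten_smul (hφ : φ (Multiplicative.ofAdd 1, 1) = 1) (h : Multiplicative ℤ × G)
    (x : EG (Multiplicative ℤ × G) × (PUnit.{1} × TwistedInterval φ)) :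
    flatten φ (h • x) = h.2 • flatten φ x := by
  refine Prod.ext (EG.map_smul _ h x.1) (Prod.ext rfl (TwistedInterval.ext ?_))
  change 1 / 2 + ((φ h : ℤ) : ℝ) * (x.2.2.val - 1 / 2) =
    1 / 2 + ((restrictHom φ h.2 : ℤ) : ℝ) * (x.2.2.val - 1 / 2)
  rw [restrictHom_snd hφ]

theorem coil_smul (hφ : φ (Multiplicative.ofAdd 1, 1) = 1) (h : Multiplicative ℤ × G) (r : ℝ)
    (x : EG G × (PUnit.{1} × TwistedInterval (restrictHom φ))) :
    coil φ (r + (Multiplicative.toAdd h.1 : ℤ), h.2 • x) = h • coil φ (r, x) := by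
  refine Prod.ext (EG.spiral_smul r h x.1) (Prod.ext rfl (TwistedInterval.ext ?_))
  change 1 / 2 + ((restrictHom φ h.2 : ℤ) : ℝ) * (x.2.2.val - 1 / 2) =
    1 / 2 + ((φ h : ℤ) : ℝ) * (x.2.2.val - 1 / 2)
  rw [restrictHom_snd hφ]

/-- The fibres of `ℝ × (EG × (pt × Ĩ)) → S¹ × (EG ×_G (pt × Ĩ))`. -/
theorem exists_of_circle_borelMk_eq
    {p q : ℝ × (EG G × (PUnit.{1} × TwistedInterval (restrictHom φ)))}
    (h : Prod.map ((↑) : ℝ → UnitAddCircle) (borelMk (restrictHom φ)) p =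
      Prod.map ((↑) : ℝ → UnitAddCircle) (borelMk (restrictHom φ)) q) :
    ∃ k : Multiplicative ℤ × G, p = (q.1 + (Multiplicative.toAdd k.1 : ℤ), k.2 • q.2) := by
  obtain ⟨h₁, h₂⟩ := Prod.ext_iff.1 h
  obtain ⟨n, hn⟩ := UnitAddCircle.coe_eq_coe_iff.1 h₁
  obtain ⟨g, hg⟩ := exists_smul_of_borelMk_eq _ h₂
  exact ⟨(Multiplicative.ofAdd n, g), Prod.ext hn hg⟩

variable [IsTopologicalGroup G]

theorem isOpenQuotientMap_circle_borelMk : IsOpenQuotientMap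
    (Prod.map ((↑) : ℝ → UnitAddCircle) (borelMk (restrictHom φ))) :=
  IsOpenQuotientMap.prodMap QuotientAddGroup.isOpenQuotientMap_mk (isOpenQuotientMap_borelMk _)

/-- An element `(n, g)` changes the height by `n`, which is invisible in the circle, and acts on the
flattened point by `g`, which is invisible in the quotient. -/
theorem exists_unwind (hφ : φ (Multiplicative.ofAdd 1, 1) = 1) :
    ∃ Θ : C(BorelConstruction (Multiplicative ℤ × G) (PUnit.{1} × TwistedInterval φ),
      UnitAddCircle × BorelConstruction G (PUnit.{1} × TwistedInterval (restrictHom φ))),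
      ∀ x, Θ (borelMk φ x) = (((EG.height x.1 : ℝ) : UnitAddCircle), borelMk _ (flatten φ x)) := by
  refine (isOpenQuotientMap_borelMk φ).exists_lift
    (f := fun x => (((EG.height x.1 : ℝ) : UnitAddCircle), borelMk _ (flatten φ x))) ?_ ?_
  · exact ((AddCircle.continuous_mk' (1 : ℝ)).comp
      (EG.continuous_height.comp continuous_fst)).prodMk
      ((isOpenQuotientMap_borelMk _).continuous.comp continuous_flatten)
  · intro x y hxy
    obtain ⟨h, rfl⟩ := exists_smul_of_borelMk_eq _ hxy
    refine Prod.ext ?_ ?_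
    · change ((EG.height (h • y.1) : ℝ) : UnitAddCircle) = _
      rw [EG.height_smul, add_comm, UnitAddCircle.coe_add_intCast]
    · change borelMk _ (flatten φ (h • y)) = _
      rw [flatten_smul hφ, borelMk_smul]

/-- The map `E(ℤ × G) ×_{ℤ × G} (pt × Ĩ) → S¹ × (EG ×_G (pt × Ĩ))`. -/
def unwind (hφ : φ (Multiplicative.ofAdd 1, 1) = 1) :
    C(BorelConstruction (Multiplicative ℤ × G) (PUnit.{1} × TwistedInterval φ),
      UnitAddCircle × BorelConstruction G (PUnit.{1} × TwistedInterval (restrictHom φ))) :=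
  (exists_unwind hφ).choose

theorem unwind_mk (hφ : φ (Multiplicative.ofAdd 1, 1) = 1)
    (x : EG (Multiplicative ℤ × G) × (PUnit.{1} × TwistedInterval φ)) :
    unwind hφ (borelMk φ x) = (((EG.height x.1 : ℝ) : UnitAddCircle), borelMk _ (flatten φ x)) :=
  (exists_unwind hφ).choose_spec x

theorem exists_rewind (hφ : φ (Multiplicative.ofAdd 1, 1) = 1) :
    ∃ Θ : C(UnitAddCircle × BorelConstruction G (PUnit.{1} × TwistedInterval (restrictHom φ)),
      BorelConstruction (Multiplicative ℤ × G) (PUnit.{1} × TwistedInterval φ)),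
      ∀ p, Θ (Prod.map (↑) (borelMk _) p) = borelMk φ (coil φ p) := by
  refine isOpenQuotientMap_circle_borelMk.exists_lift
    ((isOpenQuotientMap_borelMk _).continuous.comp continuous_coil) fun p q hpq => ?_
  obtain ⟨k, rfl⟩ := exists_of_circle_borelMk_eq hpq
  simp only [coil_smul hφ]
  exact borelMk_smul _ _ _

/-- The map `S¹ × (EG ×_G (pt × Ĩ)) → E(ℤ × G) ×_{ℤ × G} (pt × Ĩ)`. -/
def rewind (hφ : φ (Multiplicative.ofAdd 1, 1) = 1) :
    C(UnitAddCircle × BorelConstruction G (PUnit.{1} × TwistedInterval (restrictHom φ)),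
      BorelConstruction (Multiplicative ℤ × G) (PUnit.{1} × TwistedInterval φ)) :=
  (exists_rewind hφ).choose

theorem rewind_mk (hφ : φ (Multiplicative.ofAdd 1, 1) = 1)
    (p : ℝ × (EG G × (PUnit.{1} × TwistedInterval (restrictHom φ)))) :
    rewind hφ (Prod.map (↑) (borelMk _) p) = borelMk φ (coil φ p) :=
  (exists_rewind hφ).choose_spec p

theorem unwind_mem (hφ : φ (Multiplicative.ofAdd 1, 1) = 1) (b) (hb : b ∈ borelBoundary φ) :
    unwind hφ b ∈ Set.univ ×ˢ borelBoundary (restrictHom φ) := by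
  obtain ⟨e, u, x, hx, rfl⟩ := exists_of_mem_borelBoundary _ hb
  rw [unwind_mk]
  exact ⟨trivial, borelMk_mem _ hx⟩

theorem rewind_mem (hφ : φ (Multiplicative.ofAdd 1, 1) = 1) (b)
    (hb : b ∈ Set.univ ×ˢ borelBoundary (restrictHom φ)) : rewind hφ b ∈ borelBoundary φ := by
  obtain ⟨c, b⟩ := b
  obtain ⟨e, u, x, hx, rfl⟩ := exists_of_mem_borelBoundary _ hb.2
  obtain ⟨s, rfl⟩ := c.exists_coe_unitInterval
  have := rewind_mk hφ ((s : ℝ), (e, (u, x)))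
  simp only [Prod.map_apply] at this
  rw [this]
  exact borelMk_mem _ hx

/-- The composite comes from an equivariant self-map of `E(ℤ × G)` that leaves `Ĩ` alone. Applying
`Ψ` to that self-map and the identity gives an equivariant homotopy, which descends and preserves
the endpoints of `Ĩ`. -/
theorem pullback_unwind_pullback_rewind (hφ : φ (Multiplicative.ofAdd 1, 1) = 1)
    (F : OmegaSpectrum) (n : ℤ) (x : Cohomology F n
      (BorelConstruction (Multiplicative ℤ × G) (PUnit.{1} × TwistedInterval φ))
      (borelBoundary φ)) :
    Cohomology.pullback F n (unwind hφ) (unwind_mem hφ)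
      (Cohomology.pullback F n (rewind hφ) (rewind_mem hφ) x) = x := by
  obtain ⟨Ψ, hΨ, hΨ₀, hΨ₁, hΨe⟩ := EG.exists_homotopy_fst_snd (Multiplicative ℤ × G)
  obtain ⟨H, hH⟩ := (isOpenQuotientMap_borelMk φ).exists_lift_homotopy
    (f := fun p : I × (EG (Multiplicative ℤ × G) × (PUnit.{1} × TwistedInterval φ)) =>
      borelMk φ (Ψ (p.1, ((coil φ (EG.height p.2.1, flatten φ p.2)).1, p.2.1)), p.2.2))
    (by
      refine (isOpenQuotientMap_borelMk φ).continuous.comp (Continuous.prodMk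
        (hΨ.comp (continuous_fst.prodMk (Continuous.prodMk ?_ (by fun_prop)))) (by fun_prop))
      exact continuous_fst.comp (continuous_coil.comp ((EG.continuous_height.comp
        (continuous_fst.comp continuous_snd)).prodMk (continuous_flatten.comp continuous_snd))))
    (by
      intro t x y hxy
      obtain ⟨h, rfl⟩ := exists_smul_of_borelMk_eq _ hxy
      simp only
      rw [flatten_smul hφ, Prod.smul_fst, EG.height_smul, add_comm, coil_smul hφ, Prod.smul_fst,
        hΨe]
      exact borelMk_smul _ h (_, y.2))
  rw [Cohomology.pullback_pullback]
  refine (Cohomology.pullback_eq_of_homotopy F n _ (g := ContinuousMap.id _) (fun a ha => ha) H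
    ?_ ?_ ?_ x).trans (Cohomology.pullback_id F n _ x)
  · intro b
    obtain ⟨x, rfl⟩ := (isOpenQuotientMap_borelMk φ).surjective b
    have h₁ := hH 0 x
    rw [hΨ₀] at h₁
    rw [h₁, ContinuousMap.comp_apply, unwind_mk]
    exact (rewind_mk hφ (EG.height x.1, flatten φ x)).symm
  · intro b
    obtain ⟨x, rfl⟩ := (isOpenQuotientMap_borelMk φ).surjective b
    rw [hH, hΨ₁]
    rfl
  · intro t b hb
    obtain ⟨e, u, x, hx, rfl⟩ := exists_of_mem_borelBoundary _ hb
    rw [hH]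
    exact borelMk_mem _ hx

/-- On the `EG` coordinate `Ψ` does the work as before; on the real coordinate, the height of the
spiral is joined to the original number by a segment. -/
theorem pullback_rewind_pullback_unwind (hφ : φ (Multiplicative.ofAdd 1, 1) = 1)
    (F : OmegaSpectrum) (n : ℤ) (x : Cohomology F n
      (UnitAddCircle × BorelConstruction G (PUnit.{1} × TwistedInterval (restrictHom φ)))
      (Set.univ ×ˢ borelBoundary (restrictHom φ))) :
    Cohomology.pullback F n (rewind hφ) (rewind_mem hφ)
      (Cohomology.pullback F n (unwind hφ) (unwind_mem hφ) x) = x := by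
  obtain ⟨Ψ, hΨ, hΨ₀, hΨ₁, hΨe⟩ := EG.exists_homotopy_fst_snd G
  obtain ⟨H, hH⟩ := (isOpenQuotientMap_circle_borelMk (φ := φ)).exists_lift_homotopy
    (f := fun p : I × (ℝ × (EG G × (PUnit.{1} × TwistedInterval (restrictHom φ)))) =>
      ((((1 - p.1) * EG.height (coil φ p.2).1 + p.1 * p.2.1 : ℝ) : UnitAddCircle),
        borelMk (restrictHom φ) (Ψ (p.1, ((flatten φ (coil φ p.2)).1, p.2.2.1)), p.2.2.2)))
    (by
      have hc : Continuous (fun p : I × (ℝ × (EG G × (PUnit.{1} × TwistedInterval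
          (restrictHom φ)))) => coil φ p.2) := continuous_coil.comp continuous_snd
      have hh := EG.continuous_height.comp (continuous_fst.comp hc)
      have hf := continuous_fst.comp (continuous_flatten.comp hc)
      simp only [Function.comp_def] at hh hf
      refine Continuous.prodMk ((AddCircle.continuous_mk' (1 : ℝ)).comp (by fun_prop)) ?_
      exact (isOpenQuotientMap_borelMk _).continuous.comp (Continuous.prodMk
        (hΨ.comp (continuous_fst.prodMk (hf.prodMk (by fun_prop)))) (by fun_prop)))
    (by
      intro t p q hpq
      obtain ⟨k, rfl⟩ := exists_of_circle_borelMk_eq hpq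
      obtain ⟨r, y⟩ := q
      simp only
      rw [coil_smul hφ, flatten_smul hφ, Prod.smul_fst, Prod.smul_fst, Prod.smul_fst,
        EG.height_smul, hΨe]
      refine Prod.ext ?_ (borelMk_smul _ k.2 (_, y.2))
      -- Both ends of the segment are shifted by the same integer, hence so is every convex
      -- combination.
      refine UnitAddCircle.coe_eq_coe_iff.2 ⟨Multiplicative.toAdd k.1, ?_⟩
      ring)
  rw [Cohomology.pullback_pullback]
  refine (Cohomology.pullback_eq_of_homotopy F n _ (g := ContinuousMap.id _) (fun a ha => ha) H
    ?_ ?_ ?_ x).trans (Cohomology.pullback_id F n _ x)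
  · intro b
    obtain ⟨p, rfl⟩ := (isOpenQuotientMap_circle_borelMk (φ := φ)).surjective b
    rw [hH, hΨ₀, ContinuousMap.comp_apply, rewind_mk, unwind_mk]
    simp only [Set.Icc.coe_zero, sub_zero, one_mul, zero_mul, add_zero]
    rfl
  · intro b
    obtain ⟨p, rfl⟩ := (isOpenQuotientMap_circle_borelMk (φ := φ)).surjective b
    rw [hH, hΨ₁]
    simp only [Set.Icc.coe_one, sub_self, one_mul, zero_mul, zero_add]
    rfl
  · rintro t ⟨c, b⟩ ⟨-, hb⟩
    obtain ⟨e, u, x, hx, rfl⟩ := exists_of_mem_borelBoundary _ hb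
    obtain ⟨s, rfl⟩ := UnitAddCircle.exists_coe_unitInterval c
    have := hH t ((s : ℝ), (e, (u, x)))
    simp only [Prod.map_apply] at this
    rw [this]
    exact ⟨trivial, borelMk_mem _ hx⟩

theorem unwind_inclusion (hφ : φ (Multiplicative.ofAdd 1, 1) = 1)
    (b : BorelConstruction G (PUnit.{1} × TwistedInterval (restrictHom φ))) :
    unwind hφ ((Symmetry.inclusion φ).borelMap b) = (0, b) := by
  obtain ⟨x, rfl⟩ := (isOpenQuotientMap_borelMk _).surjective b
  refine (unwind_mk hφ ((Symmetry.inclusion φ).prodMap x)).trans ?_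
  refine Prod.ext ?_ rfl
  change ((EG.height (EG.map (MonoidHom.inr (Multiplicative ℤ) G) x.1) : ℝ) : UnitAddCircle) = 0
  rw [EG.height_map_inr]
  simp

end Translation

/-! ## The split short exact sequence -/

/-- The projection `ℤ × G → G`, as a morphism of symmetries. -/
def Symmetry.projection {G : Type*} [Group G] [TopologicalSpace G] [IsTopologicalGroup G]
    (φ : Multiplicative ℤ × G →ₜ* ℤˣ) (hφ : φ (Multiplicative.ofAdd 1, 1) = 1) :
    Symmetry.Hom (Symmetry.of φ) (Symmetry.restrict φ) :=
  ⟨ContinuousMonoidHom.snd (Multiplicative ℤ) G, restrictHom_snd hφ⟩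

theorem Symmetry.projection_comp_inclusion {G : Type*} [Group G] [TopologicalSpace G]
    [IsTopologicalGroup G] (φ : Multiplicative ℤ × G →ₜ* ℤˣ)
    (hφ : φ (Multiplicative.ofAdd 1, 1) = 1) :
    (Symmetry.projection φ hφ).comp (Symmetry.inclusion φ) =
      Symmetry.Hom.id (Symmetry.restrict φ) := rfl

/-- Pure functoriality of phases: the inclusion followed by the projection is the identity of `G`.
-/
theorem TopologicalPhases.sptPullback_inclusion_comp_projection (P : TopologicalPhases.{u, w})
    {G : Type u} [Group G] [TopologicalSpace G] [IsTopologicalGroup G]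
    (φ : Multiplicative ℤ × G →ₜ* ℤˣ) (hφ : φ (Multiplicative.ofAdd 1, 1) = 1) (d : ℕ) :
    (P.sptPullback d (Symmetry.inclusion φ)).comp (P.sptPullback d (Symmetry.projection φ hφ)) =
      AddMonoidHom.id _ := by
  ext x
  have h := P.pullback_comp d (Symmetry.projection φ hφ) (Symmetry.inclusion φ)
  rw [Symmetry.projection_comp_inclusion, P.pullback_id] at h
  exact (DFunLike.congr_fun h (x : P.Phase d (Symmetry.restrict φ))).symm

/-- The map `h^{φ|_G + m}_G(pt) → h^{φ + m + 1}_{ℤ × G}(pt)`. -/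
def translationMap {G : Type u} [Group G] [TopologicalSpace G] [IsTopologicalGroup G]
    {φ : Multiplicative ℤ × G →ₜ* ℤˣ} (hφ : φ (Multiplicative.ofAdd 1, 1) = 1)
    (F : OmegaSpectrum.{v}) (m : ℤ) (x : PointCohomology F m (Symmetry.restrict φ)) :
    PointCohomology F (m + 1) (Symmetry.of φ) :=
  Cohomology.pullback F (m + 1 + 1) (unwind hφ) (unwind_mem hφ) (Cohomology.suspension F (m + 1) x)

section translationMap

variable {G : Type u} [Group G] [TopologicalSpace G] [IsTopologicalGroup G]
  {φ : Multiplicative ℤ × G →ₜ* ℤˣ} (hφ : φ (Multiplicative.ofAdd 1, 1) = 1)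
  (F : OmegaSpectrum.{v}) (m : ℤ)

theorem translationMap_add (x y : PointCohomology F m (Symmetry.restrict φ)) :
    translationMap hφ F m (x + y) = translationMap hφ F m x + translationMap hφ F m y := by
  unfold translationMap
  rw [Cohomology.suspension_add, Cohomology.pullback_add]

/-- Under the comparison, forgetting translations is restriction to the basepoint of the circle,
since `unwind_inclusion` is a strict equality. -/
theorem inclusion_pullback_unwind (z : Cohomology F (m + 1 + 1)
      (UnitAddCircle × BorelConstruction G (PUnit.{1} × TwistedInterval (restrictHom φ)))
      (Set.univ ×ˢ borelBoundary (restrictHom φ))) :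
    (Symmetry.inclusion φ).pullback F (m + 1)
        (Cohomology.pullback F (m + 1 + 1) (unwind hφ) (unwind_mem hφ) z) =
      Cohomology.pullback F (m + 1 + 1) (Cohomology.atZero _)
        (A := borelBoundary (restrictHom φ)) (A' := Set.univ ×ˢ borelBoundary (restrictHom φ))
        (fun _ h => ⟨trivial, h⟩) z := by
  induction z using Quotient.inductionOn with | _ k
  refine Quotient.sound (PairMap.equiv_of_eq fun b => ?_)
  exact congrArg k.1 (unwind_inclusion hφ b)

theorem eq_const_of_translationMap_eq_const {x : PointCohomology F m (Symmetry.restrict φ)}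
    (h : translationMap hφ F m x = Cohomology.const F _ _ _) : x = Cohomology.const F _ _ _ := by
  refine Cohomology.eq_const_of_suspension_eq_const F (m + 1) x ?_
  have := congrArg (Cohomology.pullback F (m + 1 + 1) (rewind hφ) (rewind_mem hφ)) h
  unfold translationMap at this
  rwa [pullback_rewind_pullback_unwind] at this

theorem inclusion_pullback_translationMap (x : PointCohomology F m (Symmetry.restrict φ)) :
    (Symmetry.inclusion φ).pullback F (m + 1) (translationMap hφ F m x) =
      Cohomology.const F _ _ _ :=
  (inclusion_pullback_unwind hφ F m _).trans (Cohomology.pullback_atZero_suspension F (m + 1) x)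

theorem exists_translationMap_eq {y : PointCohomology F (m + 1) (Symmetry.of φ)}
    (h : (Symmetry.inclusion φ).pullback F (m + 1) y = Cohomology.const F _ _ _) :
    ∃ x, translationMap hφ F m x = y := by
  have hy := pullback_unwind_pullback_rewind hφ F (m + 1 + 1) y
  rw [← hy, inclusion_pullback_unwind hφ] at h
  obtain ⟨x, hx⟩ := Cohomology.exists_suspension_eq F (m + 1) _ h
  exact ⟨x, (congrArg (Cohomology.pullback F (m + 1 + 1) (unwind hφ) (unwind_mem hφ)) hx).trans hy⟩

end translationMap

/-- The preimage of the constant class is an idempotent in a group, hence zero. -/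
theorem AddEquiv.map_zero_eq_const {M : Type*} [AddGroup M] {F : OmegaSpectrum.{v}} {n : ℤ}
    {X : Type*} [TopologicalSpace X] {A : Set X} (e : M ≃+ Cohomology F n X A) :
    e 0 = Cohomology.const F n X A := by
  have h : e.symm (Cohomology.const F n X A) = 0 := by
    rw [← add_eq_left (a := e.symm (Cohomology.const F n X A)), ← map_add,
      Cohomology.const_add_const]
  rw [← h, e.apply_symm_apply]

/-- A split short exact sequence of abelian groups identifies its middle term with a product. -/
theorem AddMonoidHom.nonempty_equiv_prod_of_split {A B C : Type*} [AddCommGroup A]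
    [AddCommGroup B] [AddCommGroup C] (α : A →+ B) (β : B →+ C) (s : C →+ B)
    (hα : Function.Injective α) (he : Function.Exact α β) (hs : β.comp s = AddMonoidHom.id C) :
    Nonempty (B ≃+ A × C) := by
  have hβs : ∀ c, β (s c) = c := fun c => DFunLike.congr_fun hs c
  have hβα : ∀ a, β (α a) = 0 := fun a => (he (α a)).2 ⟨a, rfl⟩
  refine ⟨(AddEquiv.ofBijective (α.coprod s) ⟨?_, fun b => ?_⟩).symm⟩
  · refine (injective_iff_map_eq_zero _).2 ?_
    rintro ⟨a, c⟩ h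
    rw [AddMonoidHom.coprod_apply] at h
    have hc : c = 0 := by simpa [hβs, hβα] using congrArg β h
    rw [hc, map_zero, add_zero] at h
    exact Prod.ext (hα (h.trans (map_zero α).symm)) hc
  · obtain ⟨a, ha⟩ := (he (b - s (β b))).1 (by simp [hβs])
    exact ⟨(a, β b), by simp [ha]⟩

end

theorem proposition2
    (P : TopologicalPhases.{u, w}) (𝒢 : Symmetry.{u} → Prop)
    (hP : TopologicalPhases.GeneralizedCohomologyHypothesis.{u, v, w} 𝒢 P)
    {G : Type u} [Group G] [TopologicalSpace G] [IsTopologicalGroup G]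
    (φ : Multiplicative ℤ × G →ₜ* ℤˣ) (hφ : φ (Multiplicative.ofAdd 1, 1) = 1)
    (hG : 𝒢 (Symmetry.restrict φ)) (hZG : 𝒢 (Symmetry.of φ))
    (d : ℕ) (hd : 1 ≤ d) :
    (∃ α : P.SPT (d - 1) (Symmetry.restrict φ) →+ P.SPT d (Symmetry.of φ),
      Function.Injective α ∧
      Function.Exact α (P.sptPullback d (Symmetry.inclusion φ)) ∧
      Function.Surjective (P.sptPullback d (Symmetry.inclusion φ)) ∧
      ∃ s : P.SPT d (Symmetry.restrict φ) →+ P.SPT d (Symmetry.of φ),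
        (P.sptPullback d (Symmetry.inclusion φ)).comp s = AddMonoidHom.id _) ∧
    Nonempty (P.SPT d (Symmetry.of φ) ≃+
      P.SPT (d - 1) (Symmetry.restrict φ) × P.SPT d (Symmetry.restrict φ)) := by
  obtain ⟨F, e, he⟩ := hP
  obtain ⟨k, rfl⟩ : ∃ k, d = k + 1 := ⟨d - 1, by omega⟩
  rw [Nat.add_sub_cancel]
  -- the cohomological description in degrees `k` and `k + 1`
  let e₀ : P.SPT k (Symmetry.restrict φ) ≃+ PointCohomology F (k : ℤ) (Symmetry.restrict φ) :=
    e k _ hG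
  -- The cast of `k + 1` to `ℤ` is definitionally `(k : ℤ) + 1`, so no transport between degrees is
  -- needed.
  let e₁ : P.SPT (k + 1) (Symmetry.of φ) ≃+ PointCohomology F ((k : ℤ) + 1) (Symmetry.of φ) :=
    e (k + 1) _ hZG
  let e₂ : P.SPT (k + 1) (Symmetry.restrict φ) ≃+
      PointCohomology F ((k : ℤ) + 1) (Symmetry.restrict φ) := e (k + 1) _ hG
  have hres : ∀ x, e₂ (P.sptPullback (k + 1) (Symmetry.inclusion φ) x) =
      (Symmetry.inclusion φ).pullback F ((k : ℤ) + 1) (e₁ x) := he (k + 1) _ _ hG hZG _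
  let α : P.SPT k (Symmetry.restrict φ) →+ P.SPT (k + 1) (Symmetry.of φ) :=
    AddMonoidHom.mk' (fun x => e₁.symm (translationMap hφ F k (e₀ x))) fun x y => by
      rw [map_add, translationMap_add, map_add]
  have hα : ∀ x, e₁ (α x) = translationMap hφ F k (e₀ x) := fun x => e₁.apply_symm_apply _
  have hinj : Function.Injective α := by
    refine (injective_iff_map_eq_zero α).2 fun x hx => e₀.injective ?_
    rw [AddEquiv.map_zero_eq_const]
    exact eq_const_of_translationMap_eq_const hφ F k
      (by rw [← hα, hx]; exact AddEquiv.map_zero_eq_const e₁)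
  have hexact : Function.Exact α (P.sptPullback (k + 1) (Symmetry.inclusion φ)) := by
    intro y
    have hz := AddEquiv.map_zero_eq_const e₂
    rw [← e₂.injective.eq_iff, hres, hz]
    constructor
    · intro hy
      obtain ⟨x, hx⟩ := exists_translationMap_eq hφ F k hy
      exact ⟨e₀.symm x, e₁.injective (by rw [hα, e₀.apply_symm_apply, hx])⟩
    · rintro ⟨x, rfl⟩
      rw [hα]
      exact inclusion_pullback_translationMap hφ F k _
  -- This section supplies surjectivity, the splitting and the direct sum decomposition at once.
  have hs := P.sptPullback_inclusion_comp_projection φ hφ (k + 1)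
  exact ⟨⟨α, hinj, hexact, fun y => ⟨_, DFunLike.congr_fun hs y⟩, _, hs⟩,
    AddMonoidHom.nonempty_equiv_prod_of_split α _ _ hinj hexact hs⟩
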